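/- Let $T>0$, $c\in\mathbb R$, and let $g_0,g_1\in C^4([0,T])$ with $g_i(0)=0$ and $g_i'(0)=0$ for $i=0,1$. Let $a_0,a_1,a_2,a_3>0$ be constants and let $[\underline u,\overline u]$, $\underline u<\overline u$, be an interval containing $0$. Put $$D(F)=\{a\in H^2(\underline u,\overline u):\ a\in W^{3,\infty}(\underline u,\overline u),\ a(0)=0,\ a_0\le a'\le a_1,\ |a''|\le a_2,\ |a'''|\le a_3 \text{ a.e. on } (\underline u,\overline u)\}.$$ For $a\in D(F)$ let $(p,u)\in C^1([0,T];L^2(0,1)^2)\cap C([0,T];H^1(0,1)^2)$ be the classical solution of $$\partial_t p+\partial_x u=0,\qquad \partial_t u+\partial_x p+a(u)=0\qquad\text{in }(0,1)\times(0,T),$$ $$u(0,t)=g_0(t),\quad u(1,t)=g_1(t),\quad p(x,0)=c,\quad u(x,0)=0,$$ where $a$ is continued to $\mathbb R$ as a $C^1$ function that is affine on $(-\infty,\underline u]$ and on $[\overline u,\infty)$ (this continuation is irrelevant if, for all $a\in D(F)$, $u$ takes values in $[\underline u,\overline u]$, and $[\underline u,\overline u]$ may be chosen in this way). Let $F(a)=p(0,\cdot)-p(1,\cdot)\in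 L^2(0,T)$ be the pressure drop. Let $a^\dagger\in D(F)$ satisfy $F(a)\ne F(a^\dagger)$ for all $a\in D(F)\setminus\{a^\dagger\}$, let $h=F(a^\dagger)$, and let $a^*\in H^2(\underline u,\overline u)$. Let $\delta_n\ge 0$, $\alpha_n>0$ and $h^{\delta_n}\in L^2(0,T)$, $n\in\mathbb N$, be sequences with $$\|h^{\delta_n}-h\|_{L^2(0,T)}\le\delta_n,\qquad \delta_n\to0,\qquad \alpha_n\to0,\qquad \delta_n^2/\alpha_n\to0 ,$$ and let $a_n\in D(F)$ be a minimizer over $D(F)$ of the Tikhonov functional $$a\mapsto \|F(a)-h^{\delta_n}\|_{L^2(0,T)}^2+\alpha_n\|a-a^*\|_{H^2(\underline u,\overline u)}^2 .$$ Then $\|a_n-a^\dagger\|_{H^2(\underline u,\overline u)}\to0$ as $n\to\infty$. -/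

import Mathlib

open MeasureTheory Set Filter Topology
open scoped ContDiff ENNReal

noncomputable section

namespace DampedWave

/-- The Lebesgue space `L²(l, r)`. -/
abbrev L2 (l r : ℝ) : Type := Lp ℝ 2 (volume.restrict (Ioo l r))

/-- `g` is a weak derivative of `f` on the open interval `(l, r)`. -/
def HasWeakDeriv (l r : ℝ) (f g : ℝ → ℝ) : Prop :=
  ∀ φ : ℝ → ℝ, ContDiff ℝ ∞ φ → HasCompactSupport φ → tsupport φ ⊆ Ioo l r →
    ∫ x in Ioo l r, f x * deriv φ x = - ∫ x in Ioo l r, g x * φ x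

theorem integrable_mul_test {l r : ℝ} (f : L2 l r) {φ : ℝ → ℝ} (hφ : Continuous φ)
    (hc : HasCompactSupport φ) :
    Integrable (fun x => f x * φ x) (volume.restrict (Ioo l r)) :=
  MemLp.integrable_mul (Lp.memLp f) (hφ.memLp_of_hasCompactSupport (p := 2) hc)

theorem HasWeakDeriv.add {l r : ℝ} {f g f' g' : L2 l r} (h : HasWeakDeriv l r f g)
    (h' : HasWeakDeriv l r f' g') :
    HasWeakDeriv l r (f + f' : L2 l r) (g + g' : L2 l r) := by
  intro φ hφ hc hs
  have hd : Continuous (deriv φ) := hφ.continuous_deriv (by simp)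
  have e1 : ∫ x in Ioo l r, (f + f' : L2 l r) x * deriv φ x
      = (∫ x in Ioo l r, f x * deriv φ x) + ∫ x in Ioo l r, f' x * deriv φ x := by
    rw [← integral_add (integrable_mul_test f hd hc.deriv) (integrable_mul_test f' hd hc.deriv)]
    refine integral_congr_ae ?_
    filter_upwards [Lp.coeFn_add f f'] with x hx
    rw [hx, Pi.add_apply, add_mul]
  have e2 : ∫ x in Ioo l r, (g + g' : L2 l r) x * φ x
      = (∫ x in Ioo l r, g x * φ x) + ∫ x in Ioo l r, g' x * φ x := by
    rw [← integral_add (integrable_mul_test g hφ.continuous hc)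
      (integrable_mul_test g' hφ.continuous hc)]
    refine integral_congr_ae ?_
    filter_upwards [Lp.coeFn_add g g'] with x hx
    rw [hx, Pi.add_apply, add_mul]
  rw [e1, e2, h φ hφ hc hs, h' φ hφ hc hs]
  ring

theorem HasWeakDeriv.smul {l r : ℝ} {f g : L2 l r} (k : ℝ) (h : HasWeakDeriv l r f g) :
    HasWeakDeriv l r (k • f : L2 l r) (k • g : L2 l r) := by
  intro φ hφ hc hs
  have e1 : ∫ x in Ioo l r, (k • f : L2 l r) x * deriv φ x
      = k * ∫ x in Ioo l r, f x * deriv φ x := by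
    rw [← integral_const_mul]
    refine integral_congr_ae ?_
    filter_upwards [Lp.coeFn_smul k f] with x hx
    rw [hx, Pi.smul_apply, smul_eq_mul, mul_assoc]
  have e2 : ∫ x in Ioo l r, (k • g : L2 l r) x * φ x
      = k * ∫ x in Ioo l r, g x * φ x := by
    rw [← integral_const_mul]
    refine integral_congr_ae ?_
    filter_upwards [Lp.coeFn_smul k g] with x hx
    rw [hx, Pi.smul_apply, smul_eq_mul, mul_assoc]
  rw [e1, e2, h φ hφ hc hs]
  ring

theorem hasWeakDeriv_zero (l r : ℝ) : HasWeakDeriv l r (0 : L2 l r) (0 : L2 l r) := by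
  have h : HasWeakDeriv l r ((0 : ℝ) • (0 : L2 l r) : L2 l r) ((0 : ℝ) • (0 : L2 l r) : L2 l r) := by
    intro φ hφ hc hs
    have e : ∀ ψ : ℝ → ℝ, ∫ x in Ioo l r, ((0 : ℝ) • (0 : L2 l r) : L2 l r) x * ψ x = 0 := by
      intro ψ
      refine integral_eq_zero_of_ae ?_
      filter_upwards [Lp.coeFn_smul (0 : ℝ) (0 : L2 l r)] with x hx
      rw [hx, Pi.smul_apply, zero_smul, zero_mul, Pi.zero_apply]
    rw [e, e, neg_zero]
  simpa using h

/-- The Sobolev space `H^k(l, r)`: a function is stored together with its weak derivatives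
up to order `k`, the `i`-th component being the `i`-th weak derivative. The norm inherited from
the `ℓ²`-product is `‖f‖² = ∑_{i ≤ k} ‖f⁽ⁱ⁾‖²_{L²}`. -/
def sobolev (k : ℕ) (l r : ℝ) : Submodule ℝ (PiLp 2 (fun _ : Fin (k + 1) => L2 l r)) where
  carrier := {f | ∀ i : Fin k, HasWeakDeriv l r (f i.castSucc) (f i.succ)}
  add_mem' := fun hf hg i => (hf i).add (hg i)
  zero_mem' := fun _ => hasWeakDeriv_zero l r
  smul_mem' := fun c _ hf i => (hf i).smul c

/-- The Hilbert space `H¹(l, r)`. -/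
abbrev H1 (l r : ℝ) : Type := sobolev 1 l r

/-- The Hilbert space `H²(l, r)`. -/
abbrev H2 (l r : ℝ) : Type := sobolev 2 l r

open Classical in
/-- The representative of `f` that is continuous on `[l, r]` (for `l < r` it is unique there, and
it exists whenever `f` has a square integrable weak derivative). -/
def contRep (l r : ℝ) (f : ℝ → ℝ) : ℝ → ℝ :=
  if h : ∃ c : ℝ → ℝ, ContinuousOn c (Icc l r) ∧ c =ᵐ[volume.restrict (Ioo l r)] f
  then h.choose else 0

/-- The damping law on `ℝ` given by a parameter `a ∈ H²(l, r)`: the continuously differentiable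
representative of `a` on `[l, r]`, continued affinely with its end point slopes outside. -/
def dampingLaw {l r : ℝ} (a : H2 l r) (s : ℝ) : ℝ :=
  if s < l then contRep l r (a.1 0) l + contRep l r (a.1 1) l * (s - l)
  else if r < s then contRep l r (a.1 0) r + contRep l r (a.1 1) r * (s - r)
  else contRep l r (a.1 0) s

/-- `(p, u) ∈ C¹([0,T]; L²(0,1)²) ∩ C([0,T]; H¹(0,1)²)` is a classical solution of
`∂ₜp + ∂ₓu = 0`, `∂ₜu + ∂ₓp + a(u) = 0` on `(0,1) × (0,T)`, `u(0,t) = g₀(t)`, `u(1,t) = g₁(t)`,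
`p(x,0) = c`, `u(x,0) = 0`. -/
structure IsClassicalSolution (T c : ℝ) (g₀ g₁ a : ℝ → ℝ) (p u : ℝ → H1 0 1) : Prop where
  cont_p : ContinuousOn p (Icc 0 T)
  cont_u : ContinuousOn u (Icc 0 T)
  contDiff_p : ContDiffOn ℝ 1 (fun t => (p t).1 0) (Icc 0 T)
  contDiff_u : ContDiffOn ℝ 1 (fun t => (u t).1 0) (Icc 0 T)
  mass : ∀ t ∈ Icc 0 T, derivWithin (fun t => (p t).1 0) (Icc 0 T) t + (u t).1 1 = 0
  momentum : ∀ t ∈ Icc 0 T, ∀ᵐ x ∂(volume.restrict (Ioo (0 : ℝ) 1)),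
    derivWithin (fun t => (u t).1 0) (Icc 0 T) t x + (p t).1 1 x + a ((u t).1 0 x) = 0
  boundary_zero : ∀ t ∈ Icc 0 T, contRep 0 1 ((u t).1 0) 0 = g₀ t
  boundary_one : ∀ t ∈ Icc 0 T, contRep 0 1 ((u t).1 0) 1 = g₁ t
  initial_p : ∀ᵐ x ∂(volume.restrict (Ioo (0 : ℝ) 1)), (p 0).1 0 x = c
  initial_u : ∀ᵐ x ∂(volume.restrict (Ioo (0 : ℝ) 1)), (u 0).1 0 x = 0

/-- `q ∈ L²(0,T)` is the pressure drop `t ↦ p(0,t) - p(1,t)` of a classical solution `(p, u)`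
for the damping law `a`. -/
def IsPressureDrop (T c : ℝ) (g₀ g₁ a : ℝ → ℝ) (q : L2 0 T) : Prop :=
  ∃ p u : ℝ → H1 0 1, IsClassicalSolution T c g₀ g₁ a p u ∧
    ∀ᵐ t ∂(volume.restrict (Ioo (0 : ℝ) T)),
      q t = contRep 0 1 ((p t).1 0) 0 - contRep 0 1 ((p t).1 0) 1

open Classical in
/-- The forward operator `F`, mapping a parameter to the pressure drop of the corresponding
solution (and to `0` if there were no solution). -/
def forward (T c : ℝ) (g₀ g₁ : ℝ → ℝ) {l r : ℝ} (a : H2 l r) : L2 0 T :=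
  if h : ∃ q : L2 0 T, IsPressureDrop T c g₀ g₁ (dampingLaw a) q then h.choose else 0

/-- The domain `D(F)`: the `a ∈ H²(l, r)` with `a ∈ W^{3,∞}(l, r)`, `a(0) = 0`,
`a₀ ≤ a' ≤ a₁`, `|a''| ≤ a₂` and `|a'''| ≤ a₃` on `(l, r)`. -/
def domain (a₀ a₁ a₂ a₃ l r : ℝ) : Set (H2 l r) :=
  {a | contRep l r (a.1 0) 0 = 0 ∧
    (∀ᵐ s ∂(volume.restrict (Ioo l r)), a₀ ≤ a.1 1 s ∧ a.1 1 s ≤ a₁) ∧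
    (∀ᵐ s ∂(volume.restrict (Ioo l r)), |a.1 2 s| ≤ a₂) ∧
    ∃ w : Lp ℝ ∞ (volume.restrict (Ioo l r)), HasWeakDeriv l r (a.1 2) w ∧
      ∀ᵐ s ∂(volume.restrict (Ioo l r)), |w s| ≤ a₃}

/-- The Tikhonov functional `‖F(a) - h‖²_{L²(0,T)} + α ‖a - a*‖²_{H²(l,r)}`. -/
def tikhonov (T c : ℝ) (g₀ g₁ : ℝ → ℝ) {l r : ℝ} (h : L2 0 T) (α : ℝ) (aStar a : H2 l r) : ℝ :=
  ‖forward T c g₀ g₁ a - h‖ ^ 2 + α * ‖a - aStar‖ ^ 2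

end DampedWave

end

noncomputable section

namespace DampedWave

/-! ### Weak derivatives on an interval: the du Bois-Reymond lemma and primitives. -/

section Sobolev

variable {l r : ℝ}

/-! The bounds on `a'`, `a''`, `a'''` together with `a(0) = 0` make the parameter set compact in
`H²`: the continuous representatives of `a`, `a'`, `a''` are uniformly bounded and equi-Lipschitz,
so Arzelà–Ascoli applies to each order (`isSeqCompact_domain`). A continuous map on a compact set
that attains one value only at `a†` has an inverse that is continuous at that value, and comparing a
minimizer with `a†` forces the data of the minimizers to converge to `F(a†)`. Convergence of the
parameters follows (`tendsto_of_tendsto_forward`).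

The analytic work is continuity of `F`. The difference of two solutions with the same data solves a
linear wave system with homogeneous boundary values and source `A(u) - B(z)`. The energy identity is
applied to its time increments, divided by the step and passed to the limit, because the solutions
are only `C¹` in time (`IsLinearWave.deriv_energy_le`). Increments of the source are controlled by a
second-difference inequality for the laws, which uses that `A'` is Lipschitz; the sup norm occurring
there is bounded by the space derivative of `u - z`, hence through the mass equation by a time
derivative already present in the energy. Grönwall then bounds the difference in `H¹`, uniformly in
time, by the sup distance of `A'` and `B'` (`exists_stability_const`), and Sobolev's inequality
bounds that distance by the `H²` distance of the parameters.

Existence of solutions is never proved. If the laws of a convergent sequence have solutions, these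
form a Cauchy sequence whose limit solves the limit problem (`exists_limit_solution`). If solutions
fail to exist infinitely often along a sequence, `F` takes its default value `0` there, and the
uniqueness assumption at `a†` settles that case directly. -/

theorem setIntegral_Ioo_eq (hlr : l ≤ r) (f : ℝ → ℝ) :
    ∫ x in Ioo l r, f x = ∫ x in l..r, f x := by
  rw [intervalIntegral.integral_of_le hlr, integral_Ioc_eq_integral_Ioo]

theorem intervalIntegrable_of_integrableOn_Ioo (hlr : l ≤ r) {f : ℝ → ℝ}
    (hf : IntegrableOn f (Ioo l r)) {x y : ℝ} (hx : x ∈ Icc l r) (hy : y ∈ Icc l r) :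
    IntervalIntegrable f volume x y := by
  have h : IntervalIntegrable f volume l r :=
    (intervalIntegrable_iff_integrableOn_Ioo_of_le hlr).2 hf
  refine h.mono_set ?_
  rw [uIcc_of_le hlr]
  exact uIcc_subset_Icc hx hy

/-- An absolutely continuous function has its derivative as a weak derivative. -/
theorem hasWeakDeriv_of_absolutelyContinuous (hlr : l ≤ r) {F : ℝ → ℝ}
    (hF : AbsolutelyContinuousOnInterval F l r) : HasWeakDeriv l r F (deriv F) := by
  intro φ hφ _ hs
  have hφ' : AbsolutelyContinuousOnInterval φ l r :=
    (hφ.of_le (by simp)).contDiffOn.absolutelyContinuousOnInterval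
  have h0 : ∀ x, x ∉ Ioo l r → φ x = 0 := fun x hx => image_eq_zero_of_notMem_tsupport
    fun h => hx (hs h)
  rw [setIntegral_Ioo_eq hlr, setIntegral_Ioo_eq hlr, hF.integral_mul_deriv_eq_deriv_mul hφ',
    h0 l (by simp), h0 r (by simp)]
  ring

theorem HasWeakDeriv.congr {f g f' g' : ℝ → ℝ} (h : HasWeakDeriv l r f g)
    (hf : f =ᵐ[volume.restrict (Ioo l r)] f') (hg : g =ᵐ[volume.restrict (Ioo l r)] g') :
    HasWeakDeriv l r f' g' := by
  intro φ hφ hc hs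
  have e := h φ hφ hc hs
  have e1 : ∫ x in Ioo l r, f x * deriv φ x = ∫ x in Ioo l r, f' x * deriv φ x :=
    integral_congr_ae (hf.mul (ae_eq_refl (deriv φ)))
  have e2 : ∫ x in Ioo l r, g x * φ x = ∫ x in Ioo l r, g' x * φ x :=
    integral_congr_ae (hg.mul (ae_eq_refl φ))
  rwa [e1, e2] at e

theorem ae_deriv_primitive (hlr : l ≤ r) {g : ℝ → ℝ} (hg : IntegrableOn g (Ioo l r)) :
    deriv (fun x => ∫ t in l..x, g t) =ᵐ[volume.restrict (Ioo l r)] g := by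
  have hi := intervalIntegrable_of_integrableOn_Ioo hlr hg (left_mem_Icc.2 hlr)
    (right_mem_Icc.2 hlr)
  refine (ae_restrict_iff' measurableSet_Ioo).2 ?_
  filter_upwards [hi.ae_hasDerivAt_integral] with x hx hxm
  have hm : x ∈ uIcc l r := by rw [uIcc_of_le hlr]; exact Ioo_subset_Icc_self hxm
  exact (hx hm l left_mem_uIcc).deriv

/-- A smooth function with vanishing integral and compact support in `(l, r)` has a primitive
with compact support in `(l, r)`. -/
theorem exists_primitive_test {ψ : ℝ → ℝ} (hψ : ContDiff ℝ ∞ ψ) (hc : HasCompactSupport ψ)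
    (hs : tsupport ψ ⊆ Ioo l r) (h0 : ∫ x, ψ x = 0) :
    ∃ φ : ℝ → ℝ, ContDiff ℝ ∞ φ ∧ HasCompactSupport φ ∧ tsupport φ ⊆ Ioo l r ∧ deriv φ = ψ := by
  rcases (tsupport ψ).eq_empty_or_nonempty with he | hne
  · have hz : ψ = 0 := tsupport_eq_empty_iff.1 he
    refine ⟨0, contDiff_const, HasCompactSupport.zero, by simp, ?_⟩
    rw [hz]; simp
  obtain ⟨m, hm, hml⟩ := hc.exists_isLeast hne
  obtain ⟨M, hM, hMg⟩ := hc.exists_isGreatest hne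
  have hd : ∀ x, HasDerivAt (fun x => ∫ t in m..x, ψ t) (ψ x) x := fun x =>
    intervalIntegral.integral_hasDerivAt_right (hψ.continuous.intervalIntegrable _ _)
      (hψ.continuous.stronglyMeasurableAtFilter _ _) hψ.continuous.continuousAt
  have hde : deriv (fun x => ∫ t in m..x, ψ t) = ψ := funext fun x => (hd x).deriv
  have hz : ∀ x, x ∉ Icc m M → ψ x = 0 := fun x hx => image_eq_zero_of_notMem_tsupport
    fun h => hx ⟨hml h, hMg h⟩
  have hmM : m ≤ M := hml hM
  have hsub : Function.support (fun x => ∫ t in m..x, ψ t) ⊆ Icc m M := by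
    intro x hx
    by_contra hxm
    apply hx
    rcases lt_or_ge x m with h | h
    · refine intervalIntegral.integral_zero_ae ?_
      have : ∀ᵐ t : ℝ, t ≠ m := by simp [ae_iff]
      filter_upwards [this] with t ht htm
      rw [uIoc_of_ge h.le] at htm
      exact hz t fun h' => ht (le_antisymm htm.2 h'.1)
    · have hx' : M < x := not_le.1 fun h' => hxm ⟨h, h'⟩
      have hz' : ∀ t, t ∉ Ioc m x → t ≠ m → ψ t = 0 := by
        intro t ht htm
        refine hz t fun h' => ht ⟨lt_of_le_of_ne h'.1 (Ne.symm htm), h'.2.trans hx'.le⟩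
      -- To the right of the support the primitive has collected the whole integral of `ψ`, which is
      -- zero.
      show ∫ t in m..x, ψ t = 0
      rw [intervalIntegral.integral_of_le h, ← h0]
      rw [← integral_Icc_eq_integral_Ioc]
      exact setIntegral_eq_integral_of_forall_compl_eq_zero
        fun t ht => hz t fun h' => ht ⟨h'.1, h'.2.trans hx'.le⟩
  have hts : tsupport (fun x => ∫ t in m..x, ψ t) ⊆ Icc m M :=
    closure_minimal hsub isClosed_Icc
  refine ⟨fun x => ∫ t in m..x, ψ t, ?_, ?_, ?_, hde⟩
  · rw [contDiff_infty_iff_deriv, hde]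
    exact ⟨fun x => (hd x).differentiableAt, hψ⟩
  · exact HasCompactSupport.of_support_subset_isCompact isCompact_Icc hsub
  · exact hts.trans (Icc_subset_Ioo (hs hm).1 (hs hM).2)

/-- The lemma of du Bois-Reymond. -/
theorem HasWeakDeriv.ae_eq_const (hlr : l < r) {f : ℝ → ℝ} (hf : IntegrableOn f (Ioo l r))
    (h : HasWeakDeriv l r f 0) : ∃ k : ℝ, f =ᵐ[volume.restrict (Ioo l r)] fun _ => k := by
  -- A bump of unit mass well inside the interval. Subtracting `I * ρ` from a test function of mass
  -- `I` leaves mass zero, hence the derivative of another test function; testing against `ρ` fixes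
  -- the constant.
  let ρ₁ : ContDiffBump ((l + r) / 2) :=
    ⟨(r - l) / 8, (r - l) / 4, by linarith, by linarith⟩
  let ρ : ℝ → ℝ := ρ₁.normed volume
  have hρ : ContDiff ℝ ∞ ρ := ρ₁.contDiff_normed
  have hρc : HasCompactSupport ρ := ρ₁.hasCompactSupport_normed
  have hρs : tsupport ρ ⊆ Ioo l r := by
    have : tsupport ρ = Metric.closedBall ((l + r) / 2) ((r - l) / 4) := ρ₁.tsupport_normed_eq
    rw [this, Real.closedBall_eq_Icc]
    exact Icc_subset_Ioo (by linarith) (by linarith)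
  have hρ1 : ∫ x, ρ x = 1 := ρ₁.integral_normed
  have hint : ∀ ψ : ℝ → ℝ, ContDiff ℝ ∞ ψ → HasCompactSupport ψ →
      IntegrableOn (fun x => f x * ψ x) (Ioo l r) := by
    intro ψ hψ hψc
    obtain ⟨C, hC⟩ := hψc.exists_bound_of_continuous hψ.continuous
    exact hf.mul_bdd hψ.continuous.aestronglyMeasurable (ae_of_all _ hC)
  refine ⟨∫ x in Ioo l r, f x * ρ x, ?_⟩
  set k := ∫ x in Ioo l r, f x * ρ x with hk
  have key := isOpen_Ioo.ae_eq_zero_of_integral_contDiff_smul_eq_zero (μ := volume)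
    (U := Ioo l r) (f := fun x => f x - k)
    ((hf.sub (integrableOn_const (by simp))).locallyIntegrableOn) ?_
  · refine (ae_restrict_iff' measurableSet_Ioo).2 ?_
    filter_upwards [key] with x hx hxm
    exact sub_eq_zero.1 (hx hxm)
  intro ψ hψ hψc hψs
  have hIoo : ∀ χ : ℝ → ℝ, tsupport χ ⊆ Ioo l r → ∀ b : ℝ → ℝ,
      ∫ x, b x * χ x = ∫ x in Ioo l r, b x * χ x := by
    intro χ hχ b
    refine (setIntegral_eq_integral_of_forall_compl_eq_zero fun x hx => ?_).symm
    rw [image_eq_zero_of_notMem_tsupport fun h' => hx (hχ h'), mul_zero]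
  set I := ∫ x, ψ x with hI
  have hsub : tsupport (fun x => ψ x - I * ρ x) ⊆ Ioo l r := by
    refine (tsupport_sub ψ (fun x => I * ρ x)).trans (union_subset hψs ?_)
    exact (tsupport_mul_subset_right (f := fun _ => I) (g := ρ)).trans hρs
  have hcs : HasCompactSupport (fun x => ψ x - I * ρ x) := hψc.sub hρc.mul_left
  obtain ⟨φ, hφ, hφc, hφs, hφd⟩ := exists_primitive_test (l := l) (r := r)
    (ψ := fun x => ψ x - I * ρ x) (hψ.sub (contDiff_const.mul hρ)) hcs hsub (by
      rw [integral_sub (hψ.continuous.integrable_of_hasCompactSupport hψc)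
        ((hρ.continuous.integrable_of_hasCompactSupport hρc).const_mul I),
        integral_const_mul, hρ1]
      simp [hI])
  have h1 := h φ hφ hφc hφs
  rw [hφd] at h1
  have e : ∫ x in Ioo l r, f x * (ψ x - I * ρ x)
      = (∫ x in Ioo l r, f x * ψ x) - I * k := by
    rw [hk, ← integral_const_mul, ← integral_sub (hint ψ hψ hψc)
      ((hint ρ hρ hρc).const_mul I)]
    congr 1; ext x; ring
  rw [e] at h1
  have e2 : ∫ x, ψ x • (f x - k) = (∫ x in Ioo l r, f x * ψ x) - k * I := by
    have : ∫ x, ψ x • (f x - k) = ∫ x, (f x - k) * ψ x := by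
      congr 1; ext x; simp [mul_comm]
    rw [this, hIoo ψ hψs]
    have hI' : I = ∫ x in Ioo l r, ψ x := by
      have := hIoo ψ hψs (fun _ => 1)
      simpa using this
    rw [hI', ← integral_const_mul, ← integral_sub (hint ψ hψ hψc)
      ((hψ.continuous.integrable_of_hasCompactSupport hψc).integrableOn.const_mul k)]
    congr 1; ext x; ring
  rw [e2]
  simp only [Pi.zero_apply, zero_mul, integral_zero, neg_zero] at h1
  linarith

/-- A function with an integrable weak derivative is a primitive of it almost everywhere. -/
theorem HasWeakDeriv.ae_eq_primitive (hlr : l < r) {f g : ℝ → ℝ} (hf : IntegrableOn f (Ioo l r))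
    (hg : IntegrableOn g (Ioo l r)) (h : HasWeakDeriv l r f g) :
    ∃ k : ℝ, f =ᵐ[volume.restrict (Ioo l r)] fun x => k + ∫ t in l..x, g t := by
  set G : ℝ → ℝ := fun x => ∫ t in l..x, g t with hG
  have hi := intervalIntegrable_of_integrableOn_Ioo hlr.le hg (left_mem_Icc.2 hlr.le)
    (right_mem_Icc.2 hlr.le)
  have hac : AbsolutelyContinuousOnInterval G l r :=
    hi.absolutelyContinuousOnInterval_intervalIntegral left_mem_uIcc
  have hw : HasWeakDeriv l r G g := (hasWeakDeriv_of_absolutelyContinuous hlr.le hac).congr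
    (ae_eq_refl _) (ae_deriv_primitive hlr.le hg)
  have hGi : IntegrableOn G (Ioo l r) := by
    have := hac.continuousOn
    rw [uIcc_of_le hlr.le] at this
    exact (this.integrableOn_Icc).mono_set Ioo_subset_Icc_self
  -- `f` and the primitive `G` share the weak derivative `g`, so their difference has weak
  -- derivative zero.
  obtain ⟨k, hk⟩ := HasWeakDeriv.ae_eq_const hlr (f := fun x => f x - G x) (hf.sub hGi) (by
    intro φ hφ hc hs
    have hb : ∀ {b : ℝ → ℝ}, IntegrableOn b (Ioo l r) →
        IntegrableOn (fun x => b x * deriv φ x) (Ioo l r) := by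
      intro b hb
      have hd : Continuous (deriv φ) := hφ.continuous_deriv (by simp)
      obtain ⟨C, hC⟩ := hc.deriv.exists_bound_of_continuous hd
      exact hb.mul_bdd hd.aestronglyMeasurable (ae_of_all _ hC)
    simp only [sub_mul, Pi.zero_apply, zero_mul, integral_zero, neg_zero]
    rw [integral_sub (hb hf) (hb hGi), h φ hφ hc hs, hw φ hφ hc hs, sub_self])
  refine ⟨k, ?_⟩
  filter_upwards [hk] with x hx
  linarith

end Sobolev

/-! ### Continuous representatives, Sobolev inequalities and completeness of the Sobolev spaces. -/

section ContRep

variable {l r : ℝ}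

theorem integrableOn_L2 (f : L2 l r) : IntegrableOn f (Ioo l r) :=
  (Lp.memLp f).integrable (by norm_num)

/-- Continuous functions that agree almost everywhere agree everywhere on the closed interval, so
the choice inside `contRep` does not matter and any explicit representative may replace it. -/
theorem contRep_eqOn (hlr : l < r) {f c : ℝ → ℝ} (hc : ContinuousOn c (Icc l r))
    (hcf : c =ᵐ[volume.restrict (Ioo l r)] f) : EqOn (contRep l r f) c (Icc l r) := by
  have hex : ∃ c : ℝ → ℝ, ContinuousOn c (Icc l r) ∧ c =ᵐ[volume.restrict (Ioo l r)] f :=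
    ⟨c, hc, hcf⟩
  have h : contRep l r f = hex.choose := dif_pos hex
  rw [h]
  refine Measure.eqOn_Icc_of_ae_eq volume hlr.ne ?_ hex.choose_spec.1 hc
  rw [restrict_Ioo_eq_restrict_Icc.symm]
  exact hex.choose_spec.2.trans hcf.symm

theorem HasWeakDeriv.contRep_eq_primitive (hlr : l < r) {f g : ℝ → ℝ}
    (hf : IntegrableOn f (Ioo l r)) (hg : IntegrableOn g (Ioo l r)) (h : HasWeakDeriv l r f g) :
    ∃ k : ℝ, f =ᵐ[volume.restrict (Ioo l r)] (fun x => k + ∫ t in l..x, g t) ∧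
      ContinuousOn (fun x => k + ∫ t in l..x, g t) (Icc l r) ∧
      EqOn (contRep l r f) (fun x => k + ∫ t in l..x, g t) (Icc l r) := by
  obtain ⟨k, hk⟩ := h.ae_eq_primitive hlr hf hg
  have hi := intervalIntegrable_of_integrableOn_Ioo hlr.le hg (left_mem_Icc.2 hlr.le)
    (right_mem_Icc.2 hlr.le)
  have hc : ContinuousOn (fun x => k + ∫ t in l..x, g t) (Icc l r) := by
    have := (hi.absolutelyContinuousOnInterval_intervalIntegral left_mem_uIcc).continuousOn
    rw [uIcc_of_le hlr.le] at this
    exact continuousOn_const.add this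
  exact ⟨k, hk, hc, contRep_eqOn hlr hc hk.symm⟩

variable {f f' g g' : L2 l r}

theorem HasWeakDeriv.continuousOn_contRep (hlr : l < r) (h : HasWeakDeriv l r f f') :
    ContinuousOn (contRep l r f) (Icc l r) := by
  obtain ⟨k, _, hc, he⟩ := h.contRep_eq_primitive hlr (integrableOn_L2 f) (integrableOn_L2 f')
  exact hc.congr he

theorem HasWeakDeriv.contRep_ae_eq (hlr : l < r) (h : HasWeakDeriv l r f f') :
    contRep l r f =ᵐ[volume.restrict (Ioo l r)] f := by
  obtain ⟨k, hk, _, he⟩ := h.contRep_eq_primitive hlr (integrableOn_L2 f) (integrableOn_L2 f')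
  filter_upwards [hk, ae_restrict_mem measurableSet_Ioo] with x hx hxm
  rw [hx, he (Ioo_subset_Icc_self hxm)]

theorem HasWeakDeriv.contRep_sub_contRep (hlr : l < r) (h : HasWeakDeriv l r f f') {x y : ℝ}
    (hx : x ∈ Icc l r) (hy : y ∈ Icc l r) :
    contRep l r f y - contRep l r f x = ∫ t in x..y, f' t := by
  obtain ⟨k, _, _, he⟩ := h.contRep_eq_primitive hlr (integrableOn_L2 f) (integrableOn_L2 f')
  rw [he hx, he hy]
  have hi : ∀ {x y : ℝ}, x ∈ Icc l r → y ∈ Icc l r → IntervalIntegrable f' volume x y :=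
    fun h h' => intervalIntegrable_of_integrableOn_Ioo hlr.le (integrableOn_L2 f') h h'
  have hl := left_mem_Icc.2 hlr.le
  show (k + ∫ t in l..y, f' t) - (k + ∫ t in l..x, f' t) = _
  rw [← intervalIntegral.integral_add_adjacent_intervals (hi hl hx) (hi hx hy)]
  ring

theorem contRep_sub (hlr : l < r) (h : HasWeakDeriv l r f f') (h' : HasWeakDeriv l r g g') {x : ℝ}
    (hx : x ∈ Icc l r) :
    contRep l r (f - g : L2 l r) x = contRep l r f x - contRep l r g x := by
  refine contRep_eqOn hlr (c := fun x => contRep l r f x - contRep l r g x)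
    ((h.continuousOn_contRep hlr).sub (h'.continuousOn_contRep hlr)) ?_ hx
  filter_upwards [h.contRep_ae_eq hlr, h'.contRep_ae_eq hlr, Lp.coeFn_sub f g] with x h1 h2 h3
  rw [h1, h2, h3, Pi.sub_apply]

theorem HasWeakDeriv.sub (h : HasWeakDeriv l r f f') (h' : HasWeakDeriv l r g g') :
    HasWeakDeriv l r (f - g : L2 l r) (f' - g' : L2 l r) := by
  have := h.add (h'.smul (-1))
  simpa [sub_eq_add_neg] using this

/-- Cauchy–Schwarz against the constant `1`, in the form of the comparison of `L¹` and `L²` norms on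
a finite measure. -/
theorem integral_abs_le_norm (hlr : l ≤ r) (f : L2 l r) :
    ∫ x in Ioo l r, |f x| ≤ √(r - l) * ‖f‖ := by
  have h := eLpNorm_le_eLpNorm_mul_rpow_measure_univ (p := 1) (q := 2) (by norm_num)
    (Lp.aestronglyMeasurable f)
  have h1 : ∫ x in Ioo l r, |f x| = (eLpNorm f 1 (volume.restrict (Ioo l r))).toReal := by
    rw [eLpNorm_one_eq_lintegral_enorm, ← integral_norm_eq_lintegral_enorm
      (Lp.aestronglyMeasurable f)]
    rfl
  rw [h1, Lp.norm_def]
  have h2 : (volume.restrict (Ioo l r)) univ = ENNReal.ofReal (r - l) := by simp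
  rw [h2] at h
  have hfin : eLpNorm f 2 (volume.restrict (Ioo l r)) ≠ ⊤ := (Lp.memLp f).2.ne
  refine (ENNReal.toReal_mono (ENNReal.mul_ne_top hfin
    (ENNReal.rpow_ne_top_of_nonneg (by norm_num) (by simp))) h).trans (le_of_eq ?_)
  rw [ENNReal.toReal_mul, ← ENNReal.toReal_rpow, ENNReal.toReal_ofReal (by linarith),
    Real.sqrt_eq_rpow, mul_comm]
  norm_num

theorem HasWeakDeriv.abs_contRep_sub_le (hlr : l < r) (h : HasWeakDeriv l r f f') {x y : ℝ}
    (hx : x ∈ Icc l r) (hy : y ∈ Icc l r) :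
    |contRep l r f y - contRep l r f x| ≤ √(r - l) * ‖f'‖ := by
  rw [h.contRep_sub_contRep hlr hx hy]
  have h1 : |∫ t in x..y, f' t| ≤ ∫ t in uIoc x y, |f' t| := by
    have := intervalIntegral.norm_integral_le_integral_norm_uIoc (f := f') (a := x) (b := y)
      (μ := volume)
    simpa only [Real.norm_eq_abs] using this
  have hi : IntegrableOn (fun t => |f' t|) (Ioc l r) :=
    (integrableOn_Ioc_iff_integrableOn_Ioo).2 (integrableOn_L2 f').norm
  refine h1.trans (le_trans ?_ (integral_abs_le_norm hlr.le f'))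
  rw [← integral_Ioc_eq_integral_Ioo]
  refine setIntegral_mono_set hi (ae_of_all _ fun _ => abs_nonneg _) ?_
  refine LE.le.eventuallyLE ?_
  exact Ioc_subset_Ioc (le_min hx.1 hy.1) (max_le hx.2 hy.2)

/-- The Sobolev inequality bounding the continuous representative. -/
theorem HasWeakDeriv.abs_contRep_le (hlr : l < r) (h : HasWeakDeriv l r f f') {x : ℝ}
    (hx : x ∈ Icc l r) :
    |contRep l r f x| ≤ √(r - l) / (r - l) * ‖f‖ + √(r - l) * ‖f'‖ := by
  have hpos : 0 < r - l := sub_pos.2 hlr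
  -- The value at `x` exceeds `|f y|` by at most the oscillation bound; integrate this over `y`.
  have key : (r - l) * (|contRep l r f x| - √(r - l) * ‖f'‖) ≤ √(r - l) * ‖f‖ := by
    refine le_trans ?_ (integral_abs_le_norm hlr.le f)
    have e : (r - l) * (|contRep l r f x| - √(r - l) * ‖f'‖)
        = ∫ _y in Ioo l r, (|contRep l r f x| - √(r - l) * ‖f'‖) := by
      simp [hpos.le]
    rw [e]
    refine integral_mono_ae (integrable_const _) (integrableOn_L2 f).norm ?_
    filter_upwards [h.contRep_ae_eq hlr, ae_restrict_mem measurableSet_Ioo] with y hy hym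
    have := h.abs_contRep_sub_le hlr (Ioo_subset_Icc_self hym) hx
    rw [hy] at this
    have h3 := abs_sub_abs_le_abs_sub (contRep l r f x) (f y)
    show |contRep l r f x| - √(r - l) * ‖f'‖ ≤ |f y|
    linarith
  rw [div_mul_eq_mul_div]
  have : |contRep l r f x| - √(r - l) * ‖f'‖ ≤ √(r - l) * ‖f‖ / (r - l) := by
    rw [le_div_iff₀ hpos]; linarith
  linarith

/-- Integration by parts in `H¹(l, r)`. -/
theorem HasWeakDeriv.inner_add_inner (hlr : l < r) (h : HasWeakDeriv l r f f')
    (h' : HasWeakDeriv l r g g') :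
    inner ℝ f g' + inner ℝ f' g
      = contRep l r f r * contRep l r g r - contRep l r f l * contRep l r g l := by
  obtain ⟨k, hk, hc, he⟩ := h.contRep_eq_primitive hlr (integrableOn_L2 f) (integrableOn_L2 f')
  obtain ⟨m, hm, hd, hg⟩ := h'.contRep_eq_primitive hlr (integrableOn_L2 g) (integrableOn_L2 g')
  have hl := left_mem_Icc.2 hlr.le
  have hr := right_mem_Icc.2 hlr.le
  have hac : ∀ (j : ℝ) (u : L2 l r),
      AbsolutelyContinuousOnInterval (fun x => j + ∫ t in l..x, u t) l r := by
    intro j u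
    have h1 : AbsolutelyContinuousOnInterval (fun _ : ℝ => j) l r :=
      (contDiff_const.contDiffOn (n := 1)).absolutelyContinuousOnInterval
    exact h1.fun_add ((intervalIntegrable_of_integrableOn_Ioo hlr.le (integrableOn_L2 u)
      hl hr).absolutelyContinuousOnInterval_intervalIntegral left_mem_uIcc)
  have hder : ∀ (j : ℝ) (u : L2 l r),
      deriv (fun x => j + ∫ t in l..x, u t) =ᵐ[volume.restrict (Ioo l r)] u := by
    intro j u
    have : deriv (fun x => j + ∫ t in l..x, u t) = deriv (fun x => ∫ t in l..x, u t) := by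
      funext x; exact deriv_const_add _
    rw [this]
    exact ae_deriv_primitive hlr.le (integrableOn_L2 u)
  have hp := (hac k f').integral_deriv_mul_eq_sub (hac m g')
  rw [he hl, he hr, hg hl, hg hr, ← hp, ← setIntegral_Ioo_eq hlr.le, L2.inner_def, L2.inner_def,
    ← integral_add (L2.integrable_inner f g') (L2.integrable_inner f' g)]
  refine integral_congr_ae ?_
  filter_upwards [hk, hm, hder k f', hder m g'] with x h1 h2 h3 h4
  rw [h3, h4, ← h1, ← h2]
  simp only [RCLike.inner_apply, conj_trivial]
  ring

/-- For a fixed test function both sides of the defining identity are inner products with a fixed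
`L²` element, so they pass to limits. -/
theorem HasWeakDeriv.of_tendsto {ι : Type*} {F : Filter ι} [F.NeBot] {u v : ι → L2 l r}
    (hu : Tendsto u F (𝓝 f)) (hv : Tendsto v F (𝓝 f'))
    (h : ∀ᶠ n in F, HasWeakDeriv l r (u n) (v n)) : HasWeakDeriv l r f f' := by
  intro φ hφ hc hs
  have hlim : ∀ ψ : ℝ → ℝ, Continuous ψ → HasCompactSupport ψ → ∀ (a : ι → L2 l r) (b : L2 l r),
      Tendsto a F (𝓝 b) → Tendsto (fun n => ∫ x in Ioo l r, a n x * ψ x) F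
        (𝓝 (∫ x in Ioo l r, b x * ψ x)) := by
    intro ψ hψ hψc a b hab
    have hm : MemLp ψ 2 (volume.restrict (Ioo l r)) :=
      hψ.memLp_of_hasCompactSupport (p := 2) hψc
    have e : ∀ a : L2 l r, ∫ x in Ioo l r, a x * ψ x = inner ℝ (hm.toLp ψ) a := by
      intro a
      rw [L2.inner_def]
      refine integral_congr_ae ?_
      filter_upwards [hm.coeFn_toLp] with x hx
      simp [hx]
    simp only [e]
    exact tendsto_const_nhds.inner hab
  have hd : Continuous (deriv φ) := hφ.continuous_deriv (by simp)
  refine tendsto_nhds_unique (hlim _ hd hc.deriv u f hu) ?_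
  refine ((hlim _ hφ.continuous hc v f' hv).neg).congr' ?_
  filter_upwards [h] with n hn
  exact (hn φ hφ hc hs).symm

theorem isClosed_sobolev (k : ℕ) (l r : ℝ) :
    IsClosed (sobolev k l r : Set (PiLp 2 (fun _ : Fin (k + 1) => L2 l r))) := by
  refine IsSeqClosed.isClosed fun u a hu ha i => ?_
  have hc : ∀ j, Tendsto (fun n => u n j) atTop (𝓝 (a j)) := fun j =>
    ((PiLp.continuous_apply 2 _ j).tendsto a).comp ha
  exact HasWeakDeriv.of_tendsto (hc _) (hc _) (Eventually.of_forall fun n => hu n i)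

instance completeSpace_sobolev (k : ℕ) (l r : ℝ) : CompleteSpace (sobolev k l r) :=
  (isClosed_sobolev k l r).completeSpace_coe

theorem sobolev_norm_apply_le {k : ℕ} (f : sobolev k l r) (i : Fin (k + 1)) :
    ‖f.1 i‖ ≤ ‖f‖ :=
  PiLp.norm_apply_le f.1 i

theorem H1.hasWeakDeriv (f : H1 l r) : HasWeakDeriv l r (f.1 0) (f.1 1) := f.2 0

theorem H2.hasWeakDeriv_zero (f : H2 l r) : HasWeakDeriv l r (f.1 0) (f.1 1) := f.2 0

theorem H2.hasWeakDeriv_one (f : H2 l r) : HasWeakDeriv l r (f.1 1) (f.1 2) := f.2 1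

end ContRep

/-! ### Difference estimates for damping laws with bounded Lipschitz derivative. -/

section Laws

/-- A damping law `A` vanishing at `0`, whose derivative `A'` is bounded by `K` and
Lipschitz continuous with constant `L`. -/
structure IsRegularLaw (K L : ℝ) (A A' : ℝ → ℝ) : Prop where
  hasDerivAt : ∀ s, HasDerivAt A (A' s) s
  abs_le : ∀ s, |A' s| ≤ K
  lipschitz : ∀ s t, |A' s - A' t| ≤ L * |s - t|
  zero : A 0 = 0

variable {K L : ℝ} {A A' B B' : ℝ → ℝ}

theorem IsRegularLaw.nonneg (hA : IsRegularLaw K L A A') : 0 ≤ K :=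
  (abs_nonneg _).trans (hA.abs_le 0)

theorem IsRegularLaw.nonneg' (hA : IsRegularLaw K L A A') : 0 ≤ L := by
  simpa using (abs_nonneg _).trans (hA.lipschitz 1 0)

theorem IsRegularLaw.abs_sub_le (hA : IsRegularLaw K L A A') (x y : ℝ) :
    |A x - A y| ≤ K * |x - y| := by
  have := Convex.norm_image_sub_le_of_norm_hasDerivWithin_le (f := A) (f' := A') (s := univ)
    (C := K) (fun s _ => (hA.hasDerivAt s).hasDerivWithinAt) (fun s _ => hA.abs_le s)
    convex_univ (mem_univ y) (mem_univ x)
  simpa only [Real.norm_eq_abs] using this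

theorem IsRegularLaw.lipschitzWith (hA : IsRegularLaw K L A A') :
    LipschitzWith K.toNNReal A :=
  LipschitzWith.of_dist_le_mul fun x y => by
    rw [Real.dist_eq, Real.dist_eq, Real.coe_toNNReal _ hA.nonneg]
    exact hA.abs_sub_le x y

theorem IsRegularLaw.abs_sub_sub_sub_le (hA : IsRegularLaw K L A A')
    (hB : IsRegularLaw K L B B') {ε : ℝ} (hε : ∀ s, |A' s - B' s| ≤ ε) (x y : ℝ) :
    |A x - A y - (B x - B y)| ≤ ε * |x - y| := by
  have := Convex.norm_image_sub_le_of_norm_hasDerivWithin_le (f := fun s => A s - B s)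
    (f' := fun s => A' s - B' s) (s := univ)
    (C := ε) (fun s _ => ((hA.hasDerivAt s).sub (hB.hasDerivAt s)).hasDerivWithinAt)
    (fun s _ => hε s) convex_univ (mem_univ y) (mem_univ x)
  simp only [Real.norm_eq_abs] at this
  rwa [show A x - A y - (B x - B y) = A x - B x - (A y - B y) by ring]

theorem IsRegularLaw.abs_sub_le_add (hA : IsRegularLaw K L A A')
    (hB : IsRegularLaw K L B B') {ε : ℝ} (hε : ∀ s, |A' s - B' s| ≤ ε) (x y : ℝ) :
    |A x - B y| ≤ K * |x - y| + ε * |y| := by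
  have h1 := hA.abs_sub_le x y
  have h2 := hA.abs_sub_sub_sub_le hB hε y 0
  rw [hA.zero, hB.zero, sub_zero, sub_zero, sub_zero] at h2
  have h3 : A x - B y = (A x - A y) + (A y - B y) := by ring
  rw [h3]
  exact (abs_add_le _ _).trans (add_le_add h1 h2)

/-- Bound on the second difference of one law. -/
theorem IsRegularLaw.abs_second_diff_le (hA : IsRegularLaw K L A A') (x y x' y' : ℝ) :
    |A x' - A x - (A y' - A y)|
      ≤ K * |(x' - y') - (x - y)| + |y' - y| * (L * (|x - y| + |x' - y'|)) := by
  have hd : ∀ (z z' θ : ℝ), HasDerivAt (fun θ : ℝ => A (z + θ * (z' - z)))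
      (A' (z + θ * (z' - z)) * (z' - z)) θ := by
    intro z z' θ
    have h1 : HasDerivAt (fun θ : ℝ => z + θ * (z' - z)) (z' - z) θ := by
      simpa using ((hasDerivAt_id θ).mul_const (z' - z)).const_add z
    exact (hA.hasDerivAt _).comp θ h1
  -- Both pairs are moved along segments with a common parameter `θ`. The derivative in `θ` splits
  -- into a part proportional to the increment of the difference and a part with `A' ξ - A' η`, to
  -- which the Lipschitz bound applies.
  have key := norm_image_sub_le_of_norm_deriv_le_segment_01'
    (f := fun θ : ℝ => A (x + θ * (x' - x)) - A (y + θ * (y' - y)))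
    (f' := fun θ => A' (x + θ * (x' - x)) * (x' - x) - A' (y + θ * (y' - y)) * (y' - y))
    (C := K * |(x' - y') - (x - y)| + |y' - y| * (L * (|x - y| + |x' - y'|)))
    (fun θ _ => ((hd x x' θ).sub (hd y y' θ)).hasDerivWithinAt) ?_
  · simp only [one_mul, zero_mul, add_zero, add_sub_cancel, Real.norm_eq_abs] at key
    rwa [show A x' - A x - (A y' - A y) = A x' - A y' - (A x - A y) by ring]
  intro θ hθ
  set ξ := x + θ * (x' - x)
  set η := y + θ * (y' - y)
  have hξη : |ξ - η| ≤ |x - y| + |x' - y'| := by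
    have e : ξ - η = (1 - θ) * (x - y) + θ * (x' - y') := by simp only [ξ, η]; ring
    rw [e]
    refine (abs_add_le _ _).trans ?_
    rw [abs_mul, abs_mul, abs_of_nonneg hθ.1, abs_of_nonneg (sub_nonneg.2 hθ.2.le)]
    refine add_le_add ?_ ?_
    · exact mul_le_of_le_one_left (abs_nonneg _) (by linarith [hθ.1])
    · exact mul_le_of_le_one_left (abs_nonneg _) hθ.2.le
  have e : A' ξ * (x' - x) - A' η * (y' - y)
      = A' ξ * ((x' - y') - (x - y)) + (y' - y) * (A' ξ - A' η) := by ring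
  rw [e, Real.norm_eq_abs]
  refine (abs_add_le _ _).trans ?_
  rw [abs_mul, abs_mul]
  refine add_le_add (mul_le_mul_of_nonneg_right (hA.abs_le ξ) (abs_nonneg _)) ?_
  refine mul_le_mul_of_nonneg_left ?_ (abs_nonneg _)
  exact (hA.lipschitz ξ η).trans (mul_le_mul_of_nonneg_left hξη hA.nonneg')

/-- Replacing `B` by `A` on the increment from `y` to `y'` costs `ε * |y' - y|`, and the rest is the
estimate for a single law. With primes denoting a later time, this controls the time increment of
the source `A(u) - B(z)`. -/
theorem IsRegularLaw.abs_second_diff_le' (hA : IsRegularLaw K L A A')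
    (hB : IsRegularLaw K L B B') {ε : ℝ} (hε : ∀ s, |A' s - B' s| ≤ ε) (x y x' y' : ℝ) :
    |(A x' - B y') - (A x - B y)|
      ≤ K * |(x' - y') - (x - y)| + |y' - y| * (ε + L * (|x - y| + |x' - y'|)) := by
  have h1 := hA.abs_second_diff_le x y x' y'
  have h2 := hA.abs_sub_sub_sub_le hB hε y' y
  have e : (A x' - B y') - (A x - B y)
      = (A x' - A x - (A y' - A y)) + (A y' - A y - (B y' - B y)) := by ring
  rw [e]
  refine (abs_add_le _ _).trans ((add_le_add h1 h2).trans (le_of_eq ?_))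
  ring

end Laws

/-! ### The affinely continued law of a parameter is regular. -/

section DampingLaw

variable {l r : ℝ}

/-- `f` coincides almost everywhere with its truncations `max m f` and `min M f`, which are
continuous too, hence it coincides with them everywhere. -/
theorem mem_Icc_of_ae (hlr : l < r) {f : ℝ → ℝ} (hf : ContinuousOn f (Icc l r)) {m M : ℝ}
    (h : ∀ᵐ s ∂(volume.restrict (Ioo l r)), m ≤ f s ∧ f s ≤ M) {x : ℝ} (hx : x ∈ Icc l r) :
    m ≤ f x ∧ f x ≤ M := by
  have h1 : EqOn f (fun s => max m (f s)) (Icc l r) := by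
    refine Measure.eqOn_Icc_of_ae_eq volume hlr.ne ?_ hf (continuousOn_const.sup hf)
    rw [restrict_Ioo_eq_restrict_Icc.symm]
    filter_upwards [h] with s hs
    exact (max_eq_right hs.1).symm
  have h2 : EqOn f (fun s => min M (f s)) (Icc l r) := by
    refine Measure.eqOn_Icc_of_ae_eq volume hlr.ne ?_ hf (continuousOn_const.inf hf)
    rw [restrict_Ioo_eq_restrict_Icc.symm]
    filter_upwards [h] with s hs
    exact (min_eq_right hs.2).symm
  constructor
  · rw [h1 hx]; exact le_max_left _ _
  · rw [h2 hx]; exact min_le_left _ _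

theorem HasWeakDeriv.abs_contRep_sub_le_of_bound (hlr : l < r) {f f' : L2 l r}
    (h : HasWeakDeriv l r f f') {C : ℝ}
    (hC : ∀ᵐ s ∂(volume.restrict (Ioo l r)), |f' s| ≤ C) {x y : ℝ}
    (hx : x ∈ Icc l r) (hy : y ∈ Icc l r) :
    |contRep l r f y - contRep l r f x| ≤ C * |y - x| := by
  rw [h.contRep_sub_contRep hlr hx hy, ← Real.norm_eq_abs]
  refine intervalIntegral.norm_integral_le_of_norm_le_const_ae ?_
  have hC' := (ae_restrict_iff' measurableSet_Ioo).1 hC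
  have hr : ∀ᵐ t : ℝ, t ≠ r := by simp [ae_iff]
  filter_upwards [hC', hr] with t ht htr htm
  exact ht ⟨(le_min hx.1 hy.1).trans_lt htm.1,
    lt_of_le_of_ne (htm.2.trans (max_le hx.2 hy.2)) htr⟩

/-- The derivative of the damping law of `a`. -/
def dampingSlope (hlr : l < r) (a : H2 l r) (s : ℝ) : ℝ :=
  contRep l r (a.1 1) (projIcc l r hlr.le s)

theorem continuous_dampingSlope (hlr : l < r) (a : H2 l r) : Continuous (dampingSlope hlr a) :=
  (a.hasWeakDeriv_one.continuousOn_contRep hlr).comp_continuous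
    (continuous_subtype_val.comp continuous_projIcc) fun _ => Subtype.coe_prop _

/-- Composing with `projIcc` freezes the slope at its end point values, so the three cases of the
law become one primitive of a continuous function; differentiability across the end points is then
automatic. -/
theorem dampingLaw_eq_primitive (hlr : l < r) (a : H2 l r) (s : ℝ) :
    dampingLaw a s = contRep l r (a.1 0) l + ∫ t in l..s, dampingSlope hlr a t := by
  have hc := continuous_dampingSlope hlr a
  have hl := left_mem_Icc.2 hlr.le
  have hr := right_mem_Icc.2 hlr.le
  have hin : ∀ s ∈ Icc l r,
      contRep l r (a.1 0) s = contRep l r (a.1 0) l + ∫ t in l..s, dampingSlope hlr a t := by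
    intro s hs
    have h1 := a.hasWeakDeriv_zero.contRep_sub_contRep hlr hl hs
    have h2 : ∫ t in l..s, dampingSlope hlr a t = ∫ t in l..s, a.1 1 t := by
      refine intervalIntegral.integral_congr_ae ?_
      have h3 := (ae_restrict_iff' measurableSet_Ioo).1 (a.hasWeakDeriv_one.contRep_ae_eq hlr)
      have h4 : ∀ᵐ t : ℝ, t ≠ r := by simp [ae_iff]
      filter_upwards [h3, h4] with t ht htr htm
      rw [uIoc_of_le hs.1] at htm
      have hm : t ∈ Ioo l r := ⟨htm.1, lt_of_le_of_ne (htm.2.trans hs.2) htr⟩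
      rw [← ht hm, dampingSlope, projIcc_of_mem hlr.le (Ioo_subset_Icc_self hm)]
    rw [h2, ← h1]; ring
  unfold dampingLaw
  split_ifs with h1 h2
  · congr 1
    rw [intervalIntegral.integral_congr (g := fun _ => contRep l r (a.1 1) l)]
    · simp [mul_comm]
    · intro t ht
      rw [uIcc_of_ge h1.le] at ht
      simp only [dampingSlope]
      rw [projIcc_of_le_left hlr.le ht.2]
  · rw [hin r hr, ← intervalIntegral.integral_add_adjacent_intervals (hc.intervalIntegrable l r)
      (hc.intervalIntegrable r s), add_assoc]
    congr 2
    rw [intervalIntegral.integral_congr (g := fun _ => contRep l r (a.1 1) r)]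
    · simp [mul_comm]
    · intro t ht
      rw [uIcc_of_le h2.le] at ht
      simp only [dampingSlope]
      rw [projIcc_of_right_le hlr.le ht.1]
  · exact hin s ⟨not_lt.1 h1, not_lt.1 h2⟩

theorem hasDerivAt_dampingLaw (hlr : l < r) (a : H2 l r) (s : ℝ) :
    HasDerivAt (dampingLaw a) (dampingSlope hlr a s) s := by
  have hc := continuous_dampingSlope hlr a
  have : dampingLaw a = fun s => contRep l r (a.1 0) l + ∫ t in l..s, dampingSlope hlr a t :=
    funext (dampingLaw_eq_primitive hlr a)
  rw [this]
  exact (intervalIntegral.integral_hasDerivAt_right (hc.intervalIntegrable _ _)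
    (hc.stronglyMeasurableAtFilter _ _) hc.continuousAt).const_add _

theorem isRegularLaw_dampingLaw (hlr : l < r) (hl : l ≤ 0) (hr : 0 ≤ r) {a₀ a₁ a₂ a₃ : ℝ}
    (ha₀ : 0 < a₀) {a : H2 l r} (ha : a ∈ domain a₀ a₁ a₂ a₃ l r) :
    IsRegularLaw a₁ a₂ (dampingLaw a) (dampingSlope hlr a) where
  hasDerivAt := hasDerivAt_dampingLaw hlr a
  abs_le s := by
    have h : ∀ᵐ s ∂(volume.restrict (Ioo l r)),
        a₀ ≤ contRep l r (a.1 1) s ∧ contRep l r (a.1 1) s ≤ a₁ := by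
      filter_upwards [a.hasWeakDeriv_one.contRep_ae_eq hlr, ha.2.1] with s h1 h2
      rwa [h1]
    have := mem_Icc_of_ae hlr (a.hasWeakDeriv_one.continuousOn_contRep hlr) h
      (projIcc l r hlr.le s).2
    exact abs_le.2 ⟨by unfold dampingSlope; linarith, this.2⟩
  lipschitz s t := by
    have h2 : 0 ≤ a₂ := by
      have hne : (ae (volume.restrict (Ioo l r))).NeBot := by
        rw [ae_neBot]
        intro h
        have := congrArg (fun μ => μ univ) h
        simp at this
        linarith
      obtain ⟨x, hx⟩ := ha.2.2.1.exists
      exact (abs_nonneg _).trans hx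
    refine (a.hasWeakDeriv_one.abs_contRep_sub_le_of_bound hlr ha.2.2.1
      (projIcc l r hlr.le t).2 (projIcc l r hlr.le s).2).trans ?_
    exact mul_le_mul_of_nonneg_left (abs_projIcc_sub_projIcc hlr.le) h2
  zero := by
    unfold dampingLaw
    rw [if_neg (not_lt.2 hl), if_neg (not_lt.2 hr)]
    exact ha.1

/-- The Sobolev inequality applied to the first derivative: `H²` convergence of parameters yields
uniform convergence of the slopes, the only distance of laws entering the stability estimate. -/
theorem exists_abs_dampingSlope_sub_le (hlr : l < r) :
    ∃ C : ℝ, 0 ≤ C ∧ ∀ (a b : H2 l r) (s : ℝ),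
      |dampingSlope hlr a s - dampingSlope hlr b s| ≤ C * ‖a - b‖ := by
  have h0 : 0 ≤ √(r - l) / (r - l) := div_nonneg (Real.sqrt_nonneg _) (sub_nonneg.2 hlr.le)
  refine ⟨√(r - l) / (r - l) + √(r - l), add_nonneg h0 (Real.sqrt_nonneg _), fun a b s => ?_⟩
  have hm := (projIcc l r hlr.le s).2
  unfold dampingSlope
  rw [← contRep_sub hlr a.hasWeakDeriv_one b.hasWeakDeriv_one hm]
  refine ((a.hasWeakDeriv_one.sub b.hasWeakDeriv_one).abs_contRep_le hlr hm).trans ?_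
  rw [add_mul]
  exact add_le_add (mul_le_mul_of_nonneg_left (sobolev_norm_apply_le (a - b) 1) h0)
    (mul_le_mul_of_nonneg_left (sobolev_norm_apply_le (a - b) 2) (Real.sqrt_nonneg _))

end DampingLaw

/-! ### Difference quotients and Grönwall's inequality. -/

section Calculus

variable {E : Type*} [NormedAddCommGroup E] [NormedSpace ℝ E]

/-- The forward difference quotient. -/
def diffQuot (g : ℝ → E) (h s : ℝ) : E := h⁻¹ • (g (s + h) - g s)

variable {T : ℝ} {g g' : ℝ → E}

theorem tendsto_diffQuot (hg : ∀ t ∈ Icc 0 T, HasDerivWithinAt g (g' t) (Icc 0 T) t) {s : ℝ}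
    (hs : s ∈ Ico 0 T) : Tendsto (fun h => diffQuot g h s) (𝓝[>] 0) (𝓝 (g' s)) := by
  have h1 := hasDerivWithinAt_iff_tendsto_slope.1 (hg s ⟨hs.1, hs.2.le⟩)
  have h2 : Tendsto (fun h : ℝ => s + h) (𝓝[>] 0) (𝓝[Icc 0 T \ {s}] s) := by
    refine tendsto_nhdsWithin_iff.2 ⟨?_, ?_⟩
    · have : Tendsto (fun h : ℝ => s + h) (𝓝 0) (𝓝 (s + 0)) :=
        (continuous_const.add continuous_id).tendsto 0
      rw [add_zero] at this
      exact this.mono_left nhdsWithin_le_nhds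
    · have hT : (0 : ℝ) < T - s := sub_pos.2 hs.2
      filter_upwards [Ioo_mem_nhdsGT hT] with h hh
      refine ⟨⟨by linarith [hh.1, hs.1], by linarith [hh.2]⟩, ?_⟩
      have := hh.1
      simp only [mem_singleton_iff]
      linarith
  refine (h1.comp h2).congr fun h => ?_
  simp [slope, diffQuot]

theorem norm_diffQuot_le (hg : ∀ t ∈ Icc 0 T, HasDerivWithinAt g (g' t) (Icc 0 T) t) {C : ℝ}
    (hC : ∀ t ∈ Icc 0 T, ‖g' t‖ ≤ C) {h s : ℝ} (hh : 0 < h) (hs : s ∈ Icc 0 (T - h)) :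
    ‖diffQuot g h s‖ ≤ C := by
  have := (convex_Icc 0 T).norm_image_sub_le_of_norm_hasDerivWithin_le hg hC
    (x := s) (y := s + h) ⟨hs.1, by linarith [hs.2]⟩ ⟨by linarith [hs.1], by linarith [hs.2]⟩
  rw [add_sub_cancel_left, Real.norm_eq_abs, abs_of_pos hh] at this
  rw [diffQuot, norm_smul, norm_inv, Real.norm_eq_abs, abs_of_pos hh, inv_mul_le_iff₀ hh,
    mul_comm h]
  exact this

theorem continuousOn_shift {X : Type*} [TopologicalSpace X] {g : ℝ → X}
    (hg : ContinuousOn g (Icc 0 T)) {h : ℝ} (hh : 0 < h) :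
    ContinuousOn (fun s => g (s + h)) (Icc 0 (T - h)) :=
  hg.comp (continuous_id.add continuous_const).continuousOn fun s hs =>
    ⟨show 0 ≤ s + h by linarith [hs.1], show s + h ≤ T by linarith [hs.2]⟩

theorem continuousOn_diffQuot (hg : ContinuousOn g (Icc 0 T)) {h : ℝ} (hh : 0 < h) :
    ContinuousOn (diffQuot g h) (Icc 0 (T - h)) :=
  ((continuousOn_shift hg hh).sub (hg.mono (Icc_subset_Icc_right (by linarith)))).const_smul _

theorem hasDerivWithinAt_shift_sub
    (hg : ∀ t ∈ Icc 0 T, HasDerivWithinAt g (g' t) (Icc 0 T) t) {h : ℝ} (hh : 0 < h) :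
    ∀ t ∈ Icc 0 (T - h),
      HasDerivWithinAt (fun t => g (t + h) - g t) (g' (t + h) - g' t) (Icc 0 (T - h)) t := by
  intro t ht
  have h1 : HasDerivWithinAt (fun t : ℝ => t + h) 1 (Icc 0 (T - h)) t :=
    ((hasDerivAt_id t).add_const h).hasDerivWithinAt
  have h2 := (hg (t + h) ⟨by linarith [ht.1], by linarith [ht.2]⟩).scomp t h1
    (s := Icc 0 (T - h)) (t' := Icc 0 T) (fun s hs => ⟨show 0 ≤ s + h by linarith [hs.1],
      show s + h ≤ T by linarith [hs.2]⟩)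
  rw [one_smul] at h2
  exact h2.sub ((hg t ⟨ht.1, by linarith [ht.2]⟩).mono (Icc_subset_Icc_right (by linarith)))

/-- Grönwall's inequality in integral form. -/
theorem gronwall_integral (hT : 0 < T) {Y : ℝ → ℝ} (hY : ContinuousOn Y (Icc 0 T))
    (hY0 : ∀ t ∈ Icc 0 T, 0 ≤ Y t) {K D : ℝ} (hK : 0 < K) (hD : 0 ≤ D)
    (h : ∀ t ∈ Ico 0 T, Y t ≤ ∫ s in (0 : ℝ)..t, (K * Y s + D)) {t : ℝ} (ht : t ∈ Icc 0 T) :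
    Y t ≤ D * T * Real.exp (K * T) := by
  have hint : ∀ t ∈ Icc 0 T, IntervalIntegrable Y volume 0 t := fun t ht =>
    (hY.mono (by rw [uIcc_of_le ht.1]; exact Icc_subset_Icc_right ht.2)).intervalIntegrable
  have hYV : ∀ t ∈ Ico 0 T, Y t ≤ K * (∫ s in (0 : ℝ)..t, Y s) + D * T := by
    intro t ht
    refine (h t ht).trans ?_
    rw [intervalIntegral.integral_add ((hint t ⟨ht.1, ht.2.le⟩).const_mul K) (by simp),
      intervalIntegral.integral_const_mul]
    simp only [intervalIntegral.integral_const, sub_zero, smul_eq_mul]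
    nlinarith [mul_le_mul_of_nonneg_left ht.2.le hD]
  have hVc : ContinuousOn (fun t => ∫ s in (0 : ℝ)..t, Y s) (Icc 0 T) := by
    have := intervalIntegral.continuousOn_primitive_interval (μ := volume) (f := Y) (a := 0)
      (b := T) ((hY.integrableOn_Icc).mono_set (by rw [uIcc_of_le hT.le]))
    rwa [uIcc_of_le hT.le] at this
  have hVd : ∀ t ∈ Ico 0 T,
      HasDerivWithinAt (fun t => ∫ s in (0 : ℝ)..t, Y s) (Y t) (Ici t) t := by
    intro t ht
    have hm : Icc 0 T ∈ 𝓝[>] t :=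
      mem_of_superset (Ioo_mem_nhdsGT ht.2) fun x hx => ⟨ht.1.trans hx.1.le, hx.2.le⟩
    refine intervalIntegral.integral_hasDerivWithinAt_right (hint t ⟨ht.1, ht.2.le⟩)
      (t := Ioi t) ?_ ?_
    · exact ⟨Icc 0 T, hm, hY.aestronglyMeasurable measurableSet_Icc⟩
    · exact (hY t ⟨ht.1, ht.2.le⟩).mono_of_mem_nhdsWithin hm
  have hV0 : ∀ t ∈ Icc 0 T, 0 ≤ ∫ s in (0 : ℝ)..t, Y s := fun t ht =>
    intervalIntegral.integral_nonneg ht.1 fun s hs => hY0 s ⟨hs.1, hs.2.trans ht.2⟩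
  -- The differential form of Grönwall is applied to the integral of `Y`, whose right derivative is
  -- `Y` itself.
  have hV := norm_le_gronwallBound_of_norm_deriv_right_le (δ := 0) (K := K) (ε := D * T)
    hVc hVd (by simp) (fun t ht => by
      have ht' : t ∈ Icc 0 T := ⟨ht.1, ht.2.le⟩
      rw [Real.norm_eq_abs, Real.norm_eq_abs, abs_of_nonneg (hY0 t ht'),
        abs_of_nonneg (hV0 t ht')]
      exact hYV t ht)
  have hfin : ∀ t ∈ Ico 0 T, Y t ≤ D * T * Real.exp (K * T) := by
    intro t ht
    have h1 := hV t ⟨ht.1, ht.2.le⟩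
    rw [Real.norm_eq_abs, abs_of_nonneg (hV0 t ⟨ht.1, ht.2.le⟩),
      gronwallBound_of_K_ne_0 hK.ne'] at h1
    have h2 := hYV t ht
    have h3 : K * (∫ s in (0 : ℝ)..t, Y s) ≤ D * T * (Real.exp (K * (t - 0)) - 1) := by
      have := mul_le_mul_of_nonneg_left h1 hK.le
      refine this.trans (le_of_eq ?_)
      field_simp
      ring
    have h4 : Real.exp (K * (t - 0)) ≤ Real.exp (K * T) :=
      Real.exp_le_exp.2 (mul_le_mul_of_nonneg_left (by linarith [ht.2]) hK.le)
    have h5 := mul_le_mul_of_nonneg_left h4 (mul_nonneg hD hT.le)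
    linarith
  -- The integral inequality is available only before `T`, as forward quotients need room to the
  -- right; the end point follows by continuity.
  rcases lt_or_eq_of_le ht.2 with h' | h'
  · exact hfin t ⟨ht.1, h'⟩
  · have hcl : t ∈ closure (Ico 0 T) := by rw [closure_Ico hT.ne]; exact ht
    exact ContinuousWithinAt.closure_le hcl ((hY t ht).mono Ico_subset_Icc_self)
      continuousWithinAt_const hfin

end Calculus

/-! ### Energy estimates for the linear wave system. -/

section LinearWave

/-- `(q, w)` solves `q' + ∂ₓw = 0`, `w' + ∂ₓq + f = 0` on `(0, 1) × [0, T]` with homogeneous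
boundary conditions for `w`. -/
structure IsLinearWave (T : ℝ) (q w : ℝ → H1 0 1) (q' w' f : ℝ → L2 0 1) : Prop where
  deriv_q : ∀ t ∈ Icc 0 T, HasDerivWithinAt (fun t => (q t).1 0) (q' t) (Icc 0 T) t
  deriv_w : ∀ t ∈ Icc 0 T, HasDerivWithinAt (fun t => (w t).1 0) (w' t) (Icc 0 T) t
  cont_q' : ContinuousOn q' (Icc 0 T)
  cont_w' : ContinuousOn w' (Icc 0 T)
  cont_f : ContinuousOn f (Icc 0 T)
  mass : ∀ t ∈ Icc 0 T, q' t + (w t).1 1 = 0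
  momentum : ∀ t ∈ Icc 0 T, w' t + (q t).1 1 + f t = 0
  boundary_zero : ∀ t ∈ Icc 0 T, contRep 0 1 ((w t).1 0) 0 = 0
  boundary_one : ∀ t ∈ Icc 0 T, contRep 0 1 ((w t).1 0) 1 = 0

variable {T : ℝ} {q w : ℝ → H1 0 1} {q' w' f : ℝ → L2 0 1}

theorem IsLinearWave.continuousOn_q (H : IsLinearWave T q w q' w' f) :
    ContinuousOn (fun t => (q t).1 0) (Icc 0 T) := fun t ht => (H.deriv_q t ht).continuousWithinAt

theorem IsLinearWave.continuousOn_w (H : IsLinearWave T q w q' w' f) :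
    ContinuousOn (fun t => (w t).1 0) (Icc 0 T) := fun t ht => (H.deriv_w t ht).continuousWithinAt

/-- The cross terms `⟨q, ∂ₓw⟩ + ⟨w, ∂ₓq⟩` integrate to a boundary term, which vanishes because `w`
is zero at both ends. Only the source does work. -/
theorem IsLinearWave.energy_deriv (H : IsLinearWave T q w q' w' f) {t : ℝ} (ht : t ∈ Icc 0 T) :
    HasDerivWithinAt (fun t => ‖(q t).1 0‖ ^ 2 + ‖(w t).1 0‖ ^ 2)
      (-2 * inner ℝ ((w t).1 0) (f t)) (Icc 0 T) t := by
  have h := ((H.deriv_q t ht).norm_sq).add ((H.deriv_w t ht).norm_sq)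
  refine h.congr_deriv ?_
  have h1 : q' t = -(w t).1 1 := eq_neg_of_add_eq_zero_left (H.mass t ht)
  have h2 : w' t = -(q t).1 1 - f t := by
    have := H.momentum t ht
    rw [add_assoc] at this
    rw [eq_neg_of_add_eq_zero_left this]; abel
  have h3 := (q t).hasWeakDeriv.inner_add_inner zero_lt_one (w t).hasWeakDeriv
  rw [H.boundary_zero t ht, H.boundary_one t ht, mul_zero, mul_zero, sub_zero,
    real_inner_comm ((w t).1 0)] at h3
  rw [h1, h2, inner_neg_right, inner_sub_right, inner_neg_right]
  linarith

theorem IsLinearWave.energy_le (H : IsLinearWave T q w q' w' f) {t : ℝ} (ht : t ∈ Icc 0 T) :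
    ‖(q t).1 0‖ ^ 2 + ‖(w t).1 0‖ ^ 2 ≤ ‖(q 0).1 0‖ ^ 2 + ‖(w 0).1 0‖ ^ 2
      + ∫ s in (0 : ℝ)..t, (‖(q s).1 0‖ ^ 2 + ‖(w s).1 0‖ ^ 2 + ‖f s‖ ^ 2) := by
  have hsub : Icc 0 t ⊆ Icc 0 T := Icc_subset_Icc_right ht.2
  have hsub' : uIcc 0 t ⊆ Icc 0 T := by rw [uIcc_of_le ht.1]; exact hsub
  have hcE : ContinuousOn (fun t => ‖(q t).1 0‖ ^ 2 + ‖(w t).1 0‖ ^ 2) (Icc 0 T) :=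
    (H.continuousOn_q.norm.pow 2).add (H.continuousOn_w.norm.pow 2)
  have hce : ContinuousOn (fun t => -2 * inner ℝ ((w t).1 0) (f t)) (Icc 0 T) :=
    continuousOn_const.mul (H.continuousOn_w.inner H.cont_f)
  have hi : IntervalIntegrable (fun t => -2 * inner ℝ ((w t).1 0) (f t)) volume 0 t :=
    (hce.mono hsub').intervalIntegrable
  have hftc := intervalIntegral.integral_eq_sub_of_hasDeriv_right_of_le ht.1 (hcE.mono hsub)
    (fun x hx => (H.energy_deriv (hsub (Ioo_subset_Icc_self hx))).mono_of_mem_nhdsWithin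
      (mem_of_superset (Ioo_mem_nhdsGT hx.2) fun y hy =>
        hsub ⟨hx.1.le.trans hy.1.le, hy.2.le⟩)) hi
  have hmono : ∫ s in (0 : ℝ)..t, -2 * inner ℝ ((w s).1 0) (f s)
      ≤ ∫ s in (0 : ℝ)..t, (‖(q s).1 0‖ ^ 2 + ‖(w s).1 0‖ ^ 2 + ‖f s‖ ^ 2) := by
    refine intervalIntegral.integral_mono_on ht.1 hi
      ((hcE.add (H.cont_f.norm.pow 2)).mono hsub').intervalIntegrable fun s _ => ?_
    have h1 := neg_le_of_abs_le (abs_real_inner_le_norm ((w s).1 0) (f s))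
    nlinarith [sq_nonneg (‖(w s).1 0‖ - ‖f s‖), sq_nonneg ‖(q s).1 0‖]
  linarith

/-- The system is linear and autonomous apart from its source, so time increments obey it again and
inherit the energy estimate without a second time derivative. -/
theorem IsLinearWave.shift_sub (H : IsLinearWave T q w q' w' f) {h : ℝ} (hh : 0 < h) :
    IsLinearWave (T - h) (fun t => q (t + h) - q t) (fun t => w (t + h) - w t)
      (fun t => q' (t + h) - q' t) (fun t => w' (t + h) - w' t) (fun t => f (t + h) - f t) := by
  have hs : ∀ t ∈ Icc 0 (T - h), t ∈ Icc 0 T ∧ t + h ∈ Icc 0 T := fun t ht =>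
    ⟨⟨ht.1, by linarith [ht.2]⟩, ⟨by linarith [ht.1], by linarith [ht.2]⟩⟩
  have hsub : Icc 0 (T - h) ⊆ Icc 0 T := fun t ht => (hs t ht).1
  have hb : ∀ x ∈ Icc (0 : ℝ) 1, ∀ t, contRep 0 1 ((w (t + h) - w t).1 0) x
      = contRep 0 1 ((w (t + h)).1 0) x - contRep 0 1 ((w t).1 0) x := fun x hx t =>
    contRep_sub zero_lt_one (w (t + h)).hasWeakDeriv (w t).hasWeakDeriv hx
  refine ⟨hasDerivWithinAt_shift_sub H.deriv_q hh, hasDerivWithinAt_shift_sub H.deriv_w hh,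
    (continuousOn_shift H.cont_q' hh).sub (H.cont_q'.mono hsub),
    (continuousOn_shift H.cont_w' hh).sub (H.cont_w'.mono hsub),
    (continuousOn_shift H.cont_f hh).sub (H.cont_f.mono hsub), ?_, ?_, ?_, ?_⟩
  · intro t ht
    have h1 := H.mass _ (hs t ht).1
    have h2 := H.mass _ (hs t ht).2
    have e : q' (t + h) - q' t + (w (t + h) - w t).1 1
        = (q' (t + h) + (w (t + h)).1 1) - (q' t + (w t).1 1) := by
      show q' (t + h) - q' t + ((w (t + h)).1 1 - (w t).1 1) = _
      abel
    rw [e, h1, h2, sub_zero]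
  · intro t ht
    have h1 := H.momentum _ (hs t ht).1
    have h2 := H.momentum _ (hs t ht).2
    have e : w' (t + h) - w' t + (q (t + h) - q t).1 1 + (f (t + h) - f t)
        = (w' (t + h) + (q (t + h)).1 1 + f (t + h)) - (w' t + (q t).1 1 + f t) := by
      show w' (t + h) - w' t + ((q (t + h)).1 1 - (q t).1 1) + (f (t + h) - f t) = _
      abel
    rw [e, h1, h2, sub_zero]
  · intro t ht
    rw [hb 0 (by simp), H.boundary_zero _ (hs t ht).1, H.boundary_zero _ (hs t ht).2, sub_zero]
  · intro t ht
    rw [hb 1 (by simp), H.boundary_one _ (hs t ht).1, H.boundary_one _ (hs t ht).2, sub_zero]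

/-- The energy estimate for the time derivatives, obtained from difference quotients. -/
theorem IsLinearWave.deriv_energy_le (H : IsLinearWave T q w q' w' f) {ρ : ℝ → ℝ → ℝ} {G : ℝ → ℝ}
    {C : ℝ} (hfρ : ∀ h > 0, ∀ s ∈ Icc 0 (T - h), ‖f (s + h) - f s‖ ≤ h * ρ h s)
    (hρc : ∀ h > 0, ContinuousOn (ρ h) (Icc 0 (T - h)))
    (hρC : ∀ h > 0, ∀ s ∈ Icc 0 (T - h), ρ h s ≤ C)
    (hρG : ∀ s ∈ Ico 0 T, Tendsto (fun h => ρ h s) (𝓝[>] 0) (𝓝 (G s))) {t : ℝ}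
    (ht : t ∈ Ico 0 T) :
    ‖q' t‖ ^ 2 + ‖w' t‖ ^ 2 ≤ ‖q' 0‖ ^ 2 + ‖w' 0‖ ^ 2
      + ∫ s in (0 : ℝ)..t, (‖q' s‖ ^ 2 + ‖w' s‖ ^ 2 + G s ^ 2) := by
  obtain ⟨Cq, hCq⟩ := isCompact_Icc.exists_bound_of_continuousOn H.cont_q'
  obtain ⟨Cw, hCw⟩ := isCompact_Icc.exists_bound_of_continuousOn H.cont_w'
  set Q : ℝ → L2 0 1 := fun t => (q t).1 0 with hQ
  set W : ℝ → L2 0 1 := fun t => (w t).1 0 with hW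
  have hlim : ∀ s ∈ Ico 0 T, Tendsto (fun h => ‖diffQuot Q h s‖ ^ 2 + ‖diffQuot W h s‖ ^ 2)
      (𝓝[>] 0) (𝓝 (‖q' s‖ ^ 2 + ‖w' s‖ ^ 2)) := fun s hs =>
    ((tendsto_diffQuot H.deriv_q hs).norm.pow 2).add ((tendsto_diffQuot H.deriv_w hs).norm.pow 2)
  have hT0 : (0 : ℝ) < T - t := sub_pos.2 ht.2
  have hsmall : ∀ᶠ h in 𝓝[>] (0 : ℝ), 0 < h ∧ t ≤ T - h := by
    filter_upwards [Ioo_mem_nhdsGT hT0] with h hh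
    exact ⟨hh.1, by linarith [hh.2]⟩
  have hρ0 : ∀ h > 0, ∀ s ∈ Icc 0 (T - h), 0 ≤ ρ h s := fun h hh s hs =>
    nonneg_of_mul_nonneg_right ((norm_nonneg _).trans (hfρ h hh s hs)) hh
  have hcont : ∀ h > 0, ContinuousOn
      (fun s => ‖diffQuot Q h s‖ ^ 2 + ‖diffQuot W h s‖ ^ 2 + ρ h s ^ 2) (Icc 0 (T - h)) :=
    fun h hh => (((continuousOn_diffQuot H.continuousOn_q hh).norm.pow 2).add
      ((continuousOn_diffQuot H.continuousOn_w hh).norm.pow 2)).add ((hρc h hh).pow 2)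
  -- Dominated convergence: the quotients are bounded by the sup norms of `q'` and `w'`, and `ρ` by
  -- `C`.
  have hint : Tendsto (fun h => ∫ s in (0 : ℝ)..t,
      (‖diffQuot Q h s‖ ^ 2 + ‖diffQuot W h s‖ ^ 2 + ρ h s ^ 2)) (𝓝[>] 0)
      (𝓝 (∫ s in (0 : ℝ)..t, (‖q' s‖ ^ 2 + ‖w' s‖ ^ 2 + G s ^ 2))) := by
    refine intervalIntegral.tendsto_integral_filter_of_dominated_convergence
      (fun _ => Cq ^ 2 + Cw ^ 2 + C ^ 2) ?_ ?_ (by simp) ?_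
    · filter_upwards [hsmall] with h hh
      refine ((hcont h hh.1).mono fun s hs => ?_).aestronglyMeasurable measurableSet_uIoc
      rw [uIoc_of_le ht.1] at hs
      exact ⟨hs.1.le, hs.2.trans hh.2⟩
    · filter_upwards [hsmall] with h hh
      refine ae_of_all _ fun s hs => ?_
      rw [uIoc_of_le ht.1] at hs
      have hs' : s ∈ Icc 0 (T - h) := ⟨hs.1.le, hs.2.trans hh.2⟩
      rw [Real.norm_eq_abs, abs_of_nonneg (by positivity)]
      exact add_le_add (add_le_add
        (pow_le_pow_left₀ (norm_nonneg _) (norm_diffQuot_le H.deriv_q hCq hh.1 hs') 2)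
        (pow_le_pow_left₀ (norm_nonneg _) (norm_diffQuot_le H.deriv_w hCw hh.1 hs') 2))
        (pow_le_pow_left₀ (hρ0 h hh.1 s hs') (hρC h hh.1 s hs') 2)
    · refine ae_of_all _ fun s hs => ?_
      rw [uIoc_of_le ht.1] at hs
      have hs' : s ∈ Ico 0 T := ⟨hs.1.le, hs.2.trans_lt ht.2⟩
      exact (hlim s hs').add ((hρG s hs').pow 2)
  have h0 : (0 : ℝ) ∈ Ico 0 T := ⟨le_rfl, ht.1.trans_lt ht.2⟩
  -- It remains to prove the inequality for fixed small `h`; it is the energy estimate of the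
  -- increments multiplied by `h⁻¹ ^ 2`.
  refine le_of_tendsto_of_tendsto (hlim t ht) ((hlim 0 h0).add hint) ?_
  filter_upwards [hsmall] with h hh
  have hE := (H.shift_sub hh.1).energy_le (t := t) ⟨ht.1, hh.2⟩
  have hi2 : (0 : ℝ) < h⁻¹ ^ 2 := by have := hh.1; positivity
  have e : ∀ s, h⁻¹ ^ 2 * (‖(q (s + h) - q s).1 0‖ ^ 2 + ‖(w (s + h) - w s).1 0‖ ^ 2)
      = ‖diffQuot Q h s‖ ^ 2 + ‖diffQuot W h s‖ ^ 2 := by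
    intro s
    have e1 : ∀ z : L2 0 1, ‖h⁻¹ • z‖ ^ 2 = h⁻¹ ^ 2 * ‖z‖ ^ 2 := fun z => by
      rw [norm_smul, mul_pow, Real.norm_eq_abs, sq_abs]
    rw [diffQuot, diffQuot, e1, e1, mul_add]
    rfl
  have hE' := mul_le_mul_of_nonneg_left hE hi2.le
  rw [e t, mul_add, e 0, ← intervalIntegral.integral_const_mul] at hE'
  refine hE'.trans (add_le_add le_rfl ?_)
  have hu : uIcc 0 t ⊆ Icc 0 (T - h) := by rw [uIcc_of_le ht.1]; exact Icc_subset_Icc_right hh.2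
  refine intervalIntegral.integral_mono_on ht.1 ?_
    ((hcont h hh.1).mono hu).intervalIntegrable ?_
  · refine (ContinuousOn.mono ?_ hu).intervalIntegrable
    have H' := H.shift_sub hh.1
    exact continuousOn_const.mul (((H'.continuousOn_q.norm.pow 2).add
      (H'.continuousOn_w.norm.pow 2)).add (H'.cont_f.norm.pow 2))
  · intro s hs
    have hs' : s ∈ Icc 0 (T - h) := ⟨hs.1, hs.2.trans hh.2⟩
    rw [mul_add, e s]
    refine add_le_add le_rfl ?_
    have h1 : h⁻¹ * ‖f (s + h) - f s‖ ≤ ρ h s := by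
      rw [inv_mul_le_iff₀ hh.1]; exact hfρ h hh.1 s hs'
    have h2 := pow_le_pow_left₀ (by have := hh.1; positivity) h1 2
    rwa [mul_pow] at h2

end LinearWave

/-! ### Superposition operators on `L²` and norm forms of the pointwise bounds. -/

section L2Bounds

variable {l r : ℝ}

theorem norm_le_of_abs_le_add {g f₁ f₂ : L2 l r} {k₁ k₂ : ℝ} (h₁ : 0 ≤ k₁) (h₂ : 0 ≤ k₂)
    (h : ∀ᵐ x ∂(volume.restrict (Ioo l r)), |g x| ≤ k₁ * |f₁ x| + k₂ * |f₂ x|) :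
    ‖g‖ ≤ k₁ * ‖f₁‖ + k₂ * ‖f₂‖ := by
  have h3 : ‖g‖ ≤ ‖k₁ • |f₁| + k₂ • |f₂|‖ := by
    refine Lp.norm_le_norm_of_ae_le ?_
    filter_upwards [h, Lp.coeFn_add (k₁ • |f₁|) (k₂ • |f₂|), Lp.coeFn_smul k₁ |f₁|,
      Lp.coeFn_smul k₂ |f₂|, Lp.coeFn_abs f₁, Lp.coeFn_abs f₂] with x hx e1 e2 e3 e4 e5
    rw [e1, Pi.add_apply, e2, e3, Pi.smul_apply, Pi.smul_apply, e4, e5, smul_eq_mul, smul_eq_mul,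
      Real.norm_eq_abs, Real.norm_eq_abs]
    exact hx.trans (le_abs_self _)
  refine h3.trans ((norm_add_le _ _).trans ?_)
  rw [norm_smul, norm_smul, norm_abs_eq_norm, norm_abs_eq_norm, Real.norm_of_nonneg h₁,
    Real.norm_of_nonneg h₂]

theorem HasWeakDeriv.eq_zero {f' : L2 l r} (h : HasWeakDeriv l r (0 : L2 l r) f') : f' = 0 := by
  have key := isOpen_Ioo.ae_eq_zero_of_integral_contDiff_smul_eq_zero (μ := volume)
    (U := Ioo l r) (f := f') (integrableOn_L2 f').locallyIntegrableOn (by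
      intro φ hφ hc hs
      have h1 := h φ hφ hc hs
      have h2 : ∫ x in Ioo l r, (0 : L2 l r) x * deriv φ x = 0 := by
        refine integral_eq_zero_of_ae ?_
        filter_upwards [Lp.coeFn_zero ℝ 2 (volume.restrict (Ioo l r))] with x hx
        rw [hx]; simp
      have h3 : ∫ x, φ x • f' x = ∫ x in Ioo l r, f' x * φ x := by
        rw [setIntegral_eq_integral_of_forall_compl_eq_zero fun x hx => by
          rw [image_eq_zero_of_notMem_tsupport fun h' => hx (hs h'), mul_zero]]
        simp [mul_comm]
      rw [h3]
      linarith)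
  rw [Lp.eq_zero_iff_ae_eq_zero]
  refine (ae_restrict_iff' measurableSet_Ioo).2 ?_
  filter_upwards [key] with x hx hm
  exact hx hm

theorem H1.norm_le (f : H1 l r) : ‖f‖ ≤ ‖f.1 0‖ + ‖f.1 1‖ := by
  have h : ‖f‖ = √(‖f.1 0‖ ^ 2 + ‖f.1 1‖ ^ 2) := by
    show ‖f.1‖ = _
    rw [PiLp.norm_eq_of_L2, Fin.sum_univ_two]
  rw [h]
  refine Real.sqrt_le_iff.2 ⟨by positivity, ?_⟩
  nlinarith [mul_nonneg (norm_nonneg (f.1 0)) (norm_nonneg (f.1 1))]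

variable {K L : ℝ} {A A' B B' : ℝ → ℝ}

/-- The superposition operator of a damping law on `L²(l, r)`. -/
def IsRegularLaw.comp (hA : IsRegularLaw K L A A') (f : L2 l r) : L2 l r :=
  hA.lipschitzWith.compLp hA.zero f

theorem IsRegularLaw.coeFn_comp (hA : IsRegularLaw K L A A') (f : L2 l r) :
    hA.comp f =ᵐ[volume.restrict (Ioo l r)] fun x => A (f x) :=
  hA.lipschitzWith.coeFn_compLp hA.zero f

theorem IsRegularLaw.continuous_comp (hA : IsRegularLaw K L A A') :
    Continuous (hA.comp : L2 l r → L2 l r) :=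
  hA.lipschitzWith.continuous_compLp hA.zero

theorem IsRegularLaw.norm_comp_sub_comp_le (hA : IsRegularLaw K L A A')
    (hB : IsRegularLaw K L B B') {ε : ℝ} (hε0 : 0 ≤ ε) (hε : ∀ s, |A' s - B' s| ≤ ε)
    (f g : L2 l r) : ‖hA.comp f - hB.comp g‖ ≤ K * ‖f - g‖ + ε * ‖g‖ := by
  refine norm_le_of_abs_le_add hA.nonneg hε0 ?_
  filter_upwards [Lp.coeFn_sub (hA.comp f) (hB.comp g), hA.coeFn_comp f, hB.coeFn_comp g,
    Lp.coeFn_sub f g] with x e1 e2 e3 e4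
  rw [e1, Pi.sub_apply, e2, e3, e4]
  exact hA.abs_sub_le_add hB hε _ _

/-- The second difference contains products of `f - g` and `f' - g'` with `g' - g`. One factor must
be bounded in sup norm for the product to stay in `L²`, whence `σ` and `σ'`. -/
theorem IsRegularLaw.norm_second_diff_comp_le (hA : IsRegularLaw K L A A')
    (hB : IsRegularLaw K L B B') {ε : ℝ} (hε0 : 0 ≤ ε) (hε : ∀ s, |A' s - B' s| ≤ ε)
    {f g f' g' : L2 l r} {σ σ' : ℝ} (hσ0 : 0 ≤ σ) (hσ0' : 0 ≤ σ')
    (hσ : ∀ᵐ x ∂(volume.restrict (Ioo l r)), |(f - g : L2 l r) x| ≤ σ)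
    (hσ' : ∀ᵐ x ∂(volume.restrict (Ioo l r)), |(f' - g' : L2 l r) x| ≤ σ') :
    ‖(hA.comp f' - hB.comp g') - (hA.comp f - hB.comp g)‖
      ≤ K * ‖(f' - g') - (f - g)‖ + (ε + L * (σ + σ')) * ‖g' - g‖ := by
  have hL := hA.nonneg'
  refine norm_le_of_abs_le_add hA.nonneg (by positivity) ?_
  filter_upwards [Lp.coeFn_sub (hA.comp f' - hB.comp g') (hA.comp f - hB.comp g),
    Lp.coeFn_sub (hA.comp f) (hB.comp g), Lp.coeFn_sub (hA.comp f') (hB.comp g'),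
    hA.coeFn_comp f, hB.coeFn_comp g, hA.coeFn_comp f', hB.coeFn_comp g',
    Lp.coeFn_sub (f' - g') (f - g), Lp.coeFn_sub f g, Lp.coeFn_sub f' g', Lp.coeFn_sub g' g,
    hσ, hσ'] with x e1 e2 e3 e4 e5 e6 e7 e8 e9 e10 e11 h1 h2
  rw [e9, Pi.sub_apply] at h1
  rw [e10, Pi.sub_apply] at h2
  rw [e1, Pi.sub_apply, e2, e3, Pi.sub_apply, Pi.sub_apply, e4, e5, e6, e7, e8, Pi.sub_apply, e9,
    e10, e11, Pi.sub_apply, Pi.sub_apply, Pi.sub_apply]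
  refine (hA.abs_second_diff_le' hB hε _ _ _ _).trans (add_le_add le_rfl ?_)
  rw [mul_comm]
  refine mul_le_mul_of_nonneg_right ?_ (abs_nonneg _)
  exact add_le_add le_rfl (mul_le_mul_of_nonneg_left (add_le_add h1 h2) hL)

theorem HasWeakDeriv.ae_abs_le_of_contRep_left_eq_zero (hlr : l < r) {f f' : L2 l r}
    (h : HasWeakDeriv l r f f') (h0 : contRep l r f l = 0) :
    ∀ᵐ x ∂(volume.restrict (Ioo l r)), |f x| ≤ √(r - l) * ‖f'‖ := by
  filter_upwards [h.contRep_ae_eq hlr, ae_restrict_mem measurableSet_Ioo] with x hx hm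
  have := h.abs_contRep_sub_le hlr (left_mem_Icc.2 hlr.le) (Ioo_subset_Icc_self hm)
  rwa [h0, sub_zero, hx] at this

end L2Bounds

/-! ### Time derivatives of the difference of two solutions. -/

section Stability

variable {T c : ℝ} {g₀ g₁ A A' B B' : ℝ → ℝ} {K L : ℝ} {p u v z : ℝ → H1 0 1}

theorem IsClassicalSolution.hasDerivWithinAt_p (H : IsClassicalSolution T c g₀ g₁ A p u) {t : ℝ}
    (ht : t ∈ Icc 0 T) :
    HasDerivWithinAt (fun t => (p t).1 0) (-(u t).1 1) (Icc 0 T) t := by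
  rw [← eq_neg_of_add_eq_zero_left (H.mass t ht)]
  exact (H.contDiff_p.differentiableOn one_ne_zero t ht).hasDerivWithinAt

theorem IsClassicalSolution.derivWithin_u (hA : IsRegularLaw K L A A')
    (H : IsClassicalSolution T c g₀ g₁ A p u) {t : ℝ} (ht : t ∈ Icc 0 T) :
    derivWithin (fun t => (u t).1 0) (Icc 0 T) t + (p t).1 1 + hA.comp ((u t).1 0) = 0 := by
  rw [Lp.eq_zero_iff_ae_eq_zero]
  filter_upwards [H.momentum t ht, hA.coeFn_comp ((u t).1 0),
    Lp.coeFn_add (derivWithin (fun t => (u t).1 0) (Icc 0 T) t + (p t).1 1)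
      (hA.comp ((u t).1 0)),
    Lp.coeFn_add (derivWithin (fun t => (u t).1 0) (Icc 0 T) t) ((p t).1 1)] with x h1 h2 h3 h4
  rw [h3, Pi.add_apply, h4, Pi.add_apply, h2]
  exact h1

theorem IsClassicalSolution.hasDerivWithinAt_u (H : IsClassicalSolution T c g₀ g₁ A p u) {t : ℝ}
    (ht : t ∈ Icc 0 T) :
    HasDerivWithinAt (fun t => (u t).1 0) (derivWithin (fun t => (u t).1 0) (Icc 0 T) t)
      (Icc 0 T) t :=
  (H.contDiff_u.differentiableOn one_ne_zero t ht).hasDerivWithinAt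

theorem IsClassicalSolution.u_zero (H : IsClassicalSolution T c g₀ g₁ A p u) :
    (u 0).1 0 = 0 := by
  rw [Lp.eq_zero_iff_ae_eq_zero]
  exact H.initial_u

/-- Equal boundary data cancel, and the whole nonlinearity is put into the source. -/
theorem IsClassicalSolution.isLinearWave_sub (hT : 0 < T) (hA : IsRegularLaw K L A A')
    (hB : IsRegularLaw K L B B') (H : IsClassicalSolution T c g₀ g₁ A p u)
    (H' : IsClassicalSolution T c g₀ g₁ B v z) :
    IsLinearWave T (fun t => p t - v t) (fun t => u t - z t)
      (fun t => -(u t).1 1 - -(z t).1 1)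
      (fun t => derivWithin (fun t => (u t).1 0) (Icc 0 T) t
        - derivWithin (fun t => (z t).1 0) (Icc 0 T) t)
      (fun t => hA.comp ((u t).1 0) - hB.comp ((z t).1 0)) := by
  have hc : ∀ (i : Fin 2) {y : ℝ → H1 0 1}, ContinuousOn y (Icc 0 T) →
      ContinuousOn (fun t => (y t).1 i) (Icc 0 T) := fun i y hy =>
    ((PiLp.continuous_apply 2 _ i).comp continuous_subtype_val).comp_continuousOn hy
  have hb : ∀ x ∈ Icc (0 : ℝ) 1, ∀ t, contRep 0 1 ((u t - z t).1 0) x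
      = contRep 0 1 ((u t).1 0) x - contRep 0 1 ((z t).1 0) x := fun x hx t =>
    contRep_sub zero_lt_one (u t).hasWeakDeriv (z t).hasWeakDeriv hx
  refine ⟨fun t ht => (H.hasDerivWithinAt_p ht).sub (H'.hasDerivWithinAt_p ht),
    fun t ht => (H.hasDerivWithinAt_u ht).sub (H'.hasDerivWithinAt_u ht),
    (hc 1 H.cont_u).neg.sub (hc 1 H'.cont_u).neg,
    (H.contDiff_u.continuousOn_derivWithin (uniqueDiffOn_Icc hT) le_rfl).sub
      (H'.contDiff_u.continuousOn_derivWithin (uniqueDiffOn_Icc hT) le_rfl),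
    (hA.continuous_comp.comp_continuousOn (hc 0 H.cont_u)).sub
      (hB.continuous_comp.comp_continuousOn (hc 0 H'.cont_u)), ?_, ?_, ?_, ?_⟩
  · intro t _
    show -(u t).1 1 - -(z t).1 1 + ((u t).1 1 - (z t).1 1) = 0
    abel
  · intro t ht
    have h1 := H.derivWithin_u hA ht
    have h2 := H'.derivWithin_u hB ht
    rw [← sub_self (0 : L2 0 1)]
    nth_rewrite 1 [← h1]
    rw [← h2]
    show _ + ((p t).1 1 - (v t).1 1) + _ = _
    abel
  · intro t ht
    rw [hb 0 (by simp), H.boundary_zero t ht, H'.boundary_zero t ht, sub_self]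
  · intro t ht
    rw [hb 1 (by simp), H.boundary_one t ht, H'.boundary_one t ht, sub_self]

/-- Bound of the time derivatives of the difference of two solutions by the distance of the
derivatives of the laws. -/
theorem IsClassicalSolution.deriv_sub_energy_le (hT : 0 < T) (hA : IsRegularLaw K L A A')
    (hB : IsRegularLaw K L B B') (H : IsClassicalSolution T c g₀ g₁ A p u)
    (H' : IsClassicalSolution T c g₀ g₁ B v z) {ε M : ℝ} (hε0 : 0 ≤ ε)
    (hε : ∀ s, |A' s - B' s| ≤ ε)
    (hM : ∀ t ∈ Icc 0 T, ‖derivWithin (fun t => (z t).1 0) (Icc 0 T) t‖ ≤ M) {t : ℝ}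
    (ht : t ∈ Icc 0 T) :
    ‖-(u t).1 1 - -(z t).1 1‖ ^ 2 + ‖derivWithin (fun t => (u t).1 0) (Icc 0 T) t
        - derivWithin (fun t => (z t).1 0) (Icc 0 T) t‖ ^ 2
      ≤ 3 * (M * ε) ^ 2 * T * Real.exp ((1 + 3 * K ^ 2 + 12 * (M * L) ^ 2) * T) := by
  have hK := hA.nonneg
  have hL := hA.nonneg'
  have hW := H.isLinearWave_sub hT hA hB H'
  set q' : ℝ → L2 0 1 := fun t => -(u t).1 1 - -(z t).1 1
  set z' : ℝ → L2 0 1 := derivWithin (fun t => (z t).1 0) (Icc 0 T)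
  set w' : ℝ → L2 0 1 := fun t => derivWithin (fun t => (u t).1 0) (Icc 0 T) t - z' t
  have hM0 : 0 ≤ M := (norm_nonneg _).trans (hM t ht)
  obtain ⟨Cq, hCq⟩ := isCompact_Icc.exists_bound_of_continuousOn hW.cont_q'
  obtain ⟨Cw, hCw⟩ := isCompact_Icc.exists_bound_of_continuousOn hW.cont_w'
  have h00 : (0 : ℝ) ∈ Icc 0 T := ⟨le_rfl, hT.le⟩
  -- The initial states coincide, so the space derivatives of their difference vanish, and the
  -- equations at time `0` turn this into vanishing time derivatives.
  have hq0 : q' 0 = 0 := by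
    have hd : HasWeakDeriv 0 1 (0 : L2 0 1) ((u 0 - z 0).1 1) := by
      have h := (u 0 - z 0).hasWeakDeriv
      have e : (u 0 - z 0).1 0 = 0 := by
        show (u 0).1 0 - (z 0).1 0 = 0
        rw [H.u_zero, H'.u_zero, sub_zero]
      rwa [e] at h
    have h1 := hW.mass 0 h00
    rwa [hd.eq_zero, add_zero] at h1
  have hw0 : w' 0 = 0 := by
    have hd : HasWeakDeriv 0 1 (0 : L2 0 1) ((p 0 - v 0).1 1) := by
      have h := (p 0 - v 0).hasWeakDeriv
      have e : (p 0 - v 0).1 0 = 0 := by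
        show (p 0).1 0 - (v 0).1 0 = 0
        rw [sub_eq_zero]
        refine Lp.ext ?_
        filter_upwards [H.initial_p, H'.initial_p] with x h1 h2
        rw [h1, h2]
      rwa [e] at h
    have h1 := hW.momentum 0 h00
    have h2 : hA.comp ((u 0).1 0) - hB.comp ((z 0).1 0) = 0 := by
      rw [← norm_le_zero_iff]
      refine (hA.norm_comp_sub_comp_le hB hε0 hε _ _).trans (le_of_eq ?_)
      rw [H.u_zero, H'.u_zero]
      simp
    rwa [h2, hd.eq_zero, add_zero, add_zero] at h1
  -- This closes the estimate: `u - z` vanishes at `0`, so its sup norm is at most the norm of its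
  -- space derivative, which equals `-q'` by the mass equation.
  have hsup : ∀ t ∈ Icc 0 T, ∀ᵐ x ∂(volume.restrict (Ioo (0 : ℝ) 1)),
      |((u t).1 0 - (z t).1 0 : L2 0 1) x| ≤ ‖q' t‖ := by
    intro t ht
    have h1 := (u t - z t).hasWeakDeriv.ae_abs_le_of_contRep_left_eq_zero zero_lt_one
      (hW.boundary_zero t ht)
    have h2 : q' t = -(u t - z t).1 1 := eq_neg_of_add_eq_zero_left (hW.mass t ht)
    rw [sub_zero, Real.sqrt_one, one_mul] at h1
    rw [h2, norm_neg]
    exact h1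
  have hdz : ∀ t ∈ Icc 0 T, HasDerivWithinAt (fun t => (z t).1 0) (z' t) (Icc 0 T) t :=
    fun t ht => H'.hasDerivWithinAt_u ht
  have hcz : ContinuousOn (fun t => (z t).1 0) (Icc 0 T) :=
    fun t ht => (hdz t ht).continuousWithinAt
  have hmem : ∀ {h : ℝ}, h > 0 → ∀ s ∈ Icc 0 (T - h), s ∈ Icc 0 T ∧ s + h ∈ Icc 0 T :=
    fun hh s hs => ⟨⟨hs.1, by linarith [hs.2]⟩, ⟨by linarith [hs.1], by linarith [hs.2]⟩⟩
  have main := fun t (ht : t ∈ Ico 0 T) => hW.deriv_energy_le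
    (ρ := fun h s => K * ‖diffQuot (fun t => (u t - z t).1 0) h s‖
      + (ε + L * (‖q' s‖ + ‖q' (s + h)‖)) * ‖diffQuot (fun t => (z t).1 0) h s‖)
    (G := fun s => K * ‖w' s‖ + (ε + L * (‖q' s‖ + ‖q' s‖)) * ‖z' s‖)
    (C := K * Cw + (ε + L * (Cq + Cq)) * M) ?_ ?_ ?_ ?_ ht
  · rw [show 3 * (M * ε) ^ 2 * T * Real.exp ((1 + 3 * K ^ 2 + 12 * (M * L) ^ 2) * T)
      = (3 * (M * ε) ^ 2) * T * Real.exp ((1 + 3 * K ^ 2 + 12 * (M * L) ^ 2) * T) by ring]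
    refine gronwall_integral hT (Y := fun t => ‖q' t‖ ^ 2 + ‖w' t‖ ^ 2)
      ((hW.cont_q'.norm.pow 2).add (hW.cont_w'.norm.pow 2)) (fun _ _ => by positivity)
      (by positivity) (by positivity) (fun t ht => ?_) ht
    have h1 := main t ht
    rw [hq0, hw0, norm_zero, zero_pow two_ne_zero, add_zero, zero_add] at h1
    refine h1.trans ?_
    have hu : uIcc 0 t ⊆ Icc 0 T := by
      rw [uIcc_of_le ht.1]; exact Icc_subset_Icc_right ht.2.le
    have hcq := hW.cont_q'.norm
    have hcw := hW.cont_w'.norm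
    have hcz' : ContinuousOn (fun t => ‖z' t‖) (Icc 0 T) :=
      (H'.contDiff_u.continuousOn_derivWithin (uniqueDiffOn_Icc hT) le_rfl).norm
    refine intervalIntegral.integral_mono_on ht.1 ?_ ?_ ?_
    · refine (ContinuousOn.mono ?_ hu).intervalIntegrable
      exact ((hcq.pow 2).add (hcw.pow 2)).add (((continuousOn_const.mul hcw).add
        ((continuousOn_const.add (continuousOn_const.mul (hcq.add hcq))).mul hcz')).pow 2)
    · refine (ContinuousOn.mono ?_ hu).intervalIntegrable
      exact (continuousOn_const.mul ((hcq.pow 2).add (hcw.pow 2))).add continuousOn_const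
    · intro s hs
      have hz := hM s ⟨hs.1, hs.2.trans ht.2.le⟩
      set a := ‖q' s‖
      set b := ‖w' s‖
      have ha : 0 ≤ a := norm_nonneg _
      have hb : 0 ≤ b := norm_nonneg _
      have h2 : K * b + (ε + L * (a + a)) * ‖z' s‖ ≤ K * b + M * ε + 2 * (M * L) * a := by
        have := mul_le_mul_of_nonneg_left hz (by positivity : 0 ≤ ε + L * (a + a))
        linarith
      have h3 := pow_le_pow_left₀ (by positivity) h2 2
      -- The square of a sum of three terms costs a factor `3`. The last term gives `3 * 2 ^ 2 = 12`
      -- in the Grönwall rate, and the summand `1` there is the energy itself.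
      have h4 : (K * b + M * ε + 2 * (M * L) * a) ^ 2
          ≤ 3 * ((K * b) ^ 2 + (M * ε) ^ 2 + (2 * (M * L) * a) ^ 2) := by
        nlinarith [sq_nonneg (K * b - M * ε), sq_nonneg (K * b - 2 * (M * L) * a),
          sq_nonneg (M * ε - 2 * (M * L) * a)]
      have h5 : 0 ≤ K ^ 2 * a ^ 2 := by positivity
      have h6 : 0 ≤ (M * L) ^ 2 * b ^ 2 := by positivity
      refine (add_le_add le_rfl (h3.trans h4)).trans ?_
      nlinarith
  · intro h hh s hs
    obtain ⟨hs1, hs2⟩ := hmem hh s hs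
    have h1 := hA.norm_second_diff_comp_le hB hε0 hε (norm_nonneg (q' s))
      (norm_nonneg (q' (s + h))) (hsup s hs1) (hsup (s + h) hs2)
    refine h1.trans (le_of_eq ?_)
    simp only [diffQuot, norm_smul, norm_inv, Real.norm_eq_abs, abs_of_pos hh]
    have e : ∀ x y a b : ℝ, h * (K * (h⁻¹ * x) + a * (h⁻¹ * y)) = K * x + a * y := by
      intro x y a b
      field_simp
    -- The last argument of `e` does not occur in the identity, so any value serves.
    rw [e _ _ _ 0]
    rfl
  · intro h hh
    have hsub : Icc 0 (T - h) ⊆ Icc 0 T := fun s hs => (hmem hh s hs).1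
    exact (continuousOn_const.mul (continuousOn_diffQuot hW.continuousOn_w hh).norm).add
      ((continuousOn_const.add (continuousOn_const.mul
        ((hW.cont_q'.norm.mono hsub).add (continuousOn_shift hW.cont_q' hh).norm))).mul
        (continuousOn_diffQuot hcz hh).norm)
  · intro h hh s hs
    obtain ⟨hs1, hs2⟩ := hmem hh s hs
    have h1 := norm_diffQuot_le hW.deriv_w hCw hh hs
    have h2 := norm_diffQuot_le hdz hM hh hs
    have h3 := hCq s hs1
    have h4 := hCq (s + h) hs2
    have h5 : 0 ≤ Cq := (norm_nonneg _).trans h3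
    refine add_le_add (mul_le_mul_of_nonneg_left h1 hK)
      (mul_le_mul ?_ h2 (norm_nonneg _) (by positivity))
    exact add_le_add le_rfl (mul_le_mul_of_nonneg_left (add_le_add h3 h4) hL)
  · intro s hs
    have hshift : Tendsto (fun h => q' (s + h)) (𝓝[>] 0) (𝓝 (q' s)) := by
      have h1 := hW.cont_q' s ⟨hs.1, hs.2.le⟩
      refine h1.tendsto.comp (tendsto_nhdsWithin_iff.2 ⟨?_, ?_⟩)
      · have : Tendsto (fun h : ℝ => s + h) (𝓝 0) (𝓝 (s + 0)) :=
          (continuous_const.add continuous_id).tendsto 0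
        rw [add_zero] at this
        exact this.mono_left nhdsWithin_le_nhds
      · filter_upwards [Ioo_mem_nhdsGT (sub_pos.2 hs.2)] with h hh
        exact ⟨by linarith [hh.1, hs.1], by linarith [hh.2]⟩
    exact ((tendsto_diffQuot hW.deriv_w hs).norm.const_mul K).add
      (((tendsto_const_nhds.add hshift.norm).const_mul L |>.const_add ε).mul
        (tendsto_diffQuot hdz hs).norm)

end Stability

/-! ### Uniform limits of functions of time and of their derivatives. -/

section Limits

/-- Pointwise limits exist by completeness, and letting `m` tend to infinity in the Cauchy bound
keeps the explicit rate. -/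
theorem exists_uniform_limit {X : Type*} [NormedAddCommGroup X] [CompleteSpace X] {S : Set ℝ}
    {f : ℕ → ℝ → X} {C : ℝ} {ε : ℕ → ℝ} (hε : Tendsto ε atTop (𝓝 0))
    (h : ∀ n m, ∀ t ∈ S, ‖f n t - f m t‖ ≤ C * (ε n + ε m)) :
    ∃ g : ℝ → X, ∀ n, ∀ t ∈ S, ‖f n t - g t‖ ≤ C * ε n := by
  have hex : ∀ t, ∃ x, t ∈ S → Tendsto (fun n => f n t) atTop (𝓝 x) := by
    intro t
    by_cases ht : t ∈ S
    · have hc : CauchySeq fun n => f n t := by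
        rw [cauchySeq_iff_tendsto_dist_atTop_0]
        have h1 : Tendsto (fun k : ℕ × ℕ => C * (ε k.1 + ε k.2)) atTop (𝓝 0) := by
          rw [← prod_atTop_atTop_eq]
          have h2 : Tendsto (fun k : ℕ × ℕ => ε k.1) (atTop ×ˢ atTop) (𝓝 0) :=
            hε.comp tendsto_fst
          have h3 : Tendsto (fun k : ℕ × ℕ => ε k.2) (atTop ×ˢ atTop) (𝓝 0) :=
            hε.comp tendsto_snd
          simpa using (h2.add h3).const_mul C
        refine squeeze_zero (fun _ => dist_nonneg) (fun k => ?_) h1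
        rw [dist_eq_norm]
        exact h k.1 k.2 t ht
      obtain ⟨x, hx⟩ := cauchySeq_tendsto_of_complete hc
      exact ⟨x, fun _ => hx⟩
    · exact ⟨0, fun h => absurd h ht⟩
  choose g hg using hex
  refine ⟨g, fun n t ht => ?_⟩
  have h1 : Tendsto (fun m => ‖f n t - f m t‖) atTop (𝓝 ‖f n t - g t‖) :=
    (tendsto_const_nhds.sub (hg t ht)).norm
  have h2 : Tendsto (fun m => C * (ε n + ε m)) atTop (𝓝 (C * (ε n + 0))) :=
    (tendsto_const_nhds.add hε).const_mul C
  rw [add_zero] at h2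
  exact le_of_tendsto_of_tendsto' h1 h2 fun m => h n m t ht

theorem tendstoUniformlyOn_of_norm_le {X : Type*} [NormedAddCommGroup X] {S : Set ℝ}
    {f : ℕ → ℝ → X} {g : ℝ → X} {ε : ℕ → ℝ} (hε : Tendsto ε atTop (𝓝 0))
    (h : ∀ n, ∀ t ∈ S, ‖f n t - g t‖ ≤ ε n) : TendstoUniformlyOn f g atTop S := by
  rw [Metric.tendstoUniformlyOn_iff]
  intro η hη
  filter_upwards [hε.eventually (gt_mem_nhds hη)] with n hn t ht
  rw [dist_comm, dist_eq_norm]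
  exact (h n t ht).trans_lt hn

theorem tendsto_of_norm_sub_le {X : Type*} [NormedAddCommGroup X] {f : ℕ → X} {g : X} {ε : ℕ → ℝ}
    (hε : Tendsto ε atTop (𝓝 0)) (h : ∀ n, ‖f n - g‖ ≤ ε n) : Tendsto f atTop (𝓝 g) :=
  tendsto_iff_norm_sub_tendsto_zero.2 (squeeze_zero (fun _ => norm_nonneg _) h hε)

/-- A limit of differentiable functions whose derivatives converge uniformly is
differentiable. -/
theorem hasDerivWithinAt_of_uniform_limit {X : Type*} [NormedAddCommGroup X] [NormedSpace ℝ X]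
    [CompleteSpace X] {T : ℝ} (hT : 0 < T) {f f' : ℕ → ℝ → X} {g g' : ℝ → X} {ε : ℕ → ℝ}
    (hε : Tendsto ε atTop (𝓝 0))
    (hd : ∀ n, ∀ t ∈ Icc 0 T, HasDerivWithinAt (f n) (f' n t) (Icc 0 T) t)
    (hc : ∀ n, ContinuousOn (f' n) (Icc 0 T))
    (hf : ∀ t ∈ Icc 0 T, Tendsto (fun n => f n t) atTop (𝓝 (g t)))
    (hf' : ∀ n, ∀ t ∈ Icc 0 T, ‖f' n t - g' t‖ ≤ ε n) :
    ContinuousOn g' (Icc 0 T) ∧ ∀ t ∈ Icc 0 T, HasDerivWithinAt g (g' t) (Icc 0 T) t := by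
  have hcg : ContinuousOn g' (Icc 0 T) :=
    (tendstoUniformlyOn_of_norm_le hε hf').continuousOn (Eventually.of_forall hc).frequently
  refine ⟨hcg, ?_⟩
  have h0 : (0 : ℝ) ∈ Icc 0 T := ⟨le_rfl, hT.le⟩
  have hi : ∀ {t : ℝ}, t ∈ Icc 0 T → ∀ {k : ℝ → X}, ContinuousOn k (Icc 0 T) →
      IntervalIntegrable k volume 0 t := fun ht _ hk =>
    (hk.mono (by rw [uIcc_of_le ht.1]; exact Icc_subset_Icc_right ht.2)).intervalIntegrable
  have hint : ∀ t ∈ Icc 0 T, g t = g 0 + ∫ s in (0 : ℝ)..t, g' s := by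
    intro t ht
    have hsub : Icc 0 t ⊆ Icc 0 T := Icc_subset_Icc_right ht.2
    have h1 : ∀ n, f n t = f n 0 + ∫ s in (0 : ℝ)..t, f' n s := by
      intro n
      have hfc : ContinuousOn (f n) (Icc 0 T) := fun s hs => (hd n s hs).continuousWithinAt
      rw [intervalIntegral.integral_eq_sub_of_hasDeriv_right_of_le ht.1 (hfc.mono hsub)
        (fun x hx => (hd n x (hsub (Ioo_subset_Icc_self hx))).mono_of_mem_nhdsWithin
          (mem_of_superset (Ioo_mem_nhdsGT hx.2) fun y hy =>
            hsub ⟨hx.1.le.trans hy.1.le, hy.2.le⟩)) (hi ht (hc n))]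
      abel
    have h2 : Tendsto (fun n => ∫ s in (0 : ℝ)..t, f' n s) atTop
        (𝓝 (∫ s in (0 : ℝ)..t, g' s)) := by
      have h3 : Tendsto (fun n => ε n * |t - 0|) atTop (𝓝 0) := by
        simpa using hε.mul_const |t - 0|
      refine tendsto_of_norm_sub_le h3 fun n => ?_
      rw [← intervalIntegral.integral_sub (hi ht (hc n)) (hi ht hcg)]
      refine intervalIntegral.norm_integral_le_of_norm_le_const fun s hs => ?_
      rw [uIoc_of_le ht.1] at hs
      exact hf' n s ⟨hs.1.le, hs.2.trans ht.2⟩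
    refine tendsto_nhds_unique (hf t ht) ?_
    simp only [h1]
    exact (hf 0 h0).add h2
  intro t ht
  -- Constant continuation makes the integrand continuous on the whole line, so the fundamental
  -- theorem needs no one-sided version at the end points.
  set k : ℝ → X := fun s => g' (projIcc 0 T hT.le s) with hk
  have hkc : Continuous k := hcg.comp_continuous
    (continuous_subtype_val.comp continuous_projIcc) fun _ => Subtype.coe_prop _
  have hgk : ∀ s ∈ Icc 0 T, g s = g 0 + ∫ τ in (0 : ℝ)..s, k τ := by
    intro s hs
    rw [hint s hs]
    congr 1
    refine intervalIntegral.integral_congr fun τ hτ => ?_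
    rw [uIcc_of_le hs.1] at hτ
    simp only [hk]
    rw [projIcc_of_mem hT.le ⟨hτ.1, hτ.2.trans hs.2⟩]
  have hdk : HasDerivAt (fun s => g 0 + ∫ τ in (0 : ℝ)..s, k τ) (k t) t :=
    (intervalIntegral.integral_hasDerivAt_right (hkc.intervalIntegrable _ _)
      (hkc.stronglyMeasurableAtFilter _ _) hkc.continuousAt).const_add _
  have hkt : k t = g' t := by simp only [hk]; rw [projIcc_of_mem hT.le ht]
  rw [← hkt]
  exact hdk.hasDerivWithinAt.congr hgk (hgk t ht)

theorem norm_le_mul_of_deriv_le {X : Type*} [NormedAddCommGroup X] [NormedSpace ℝ X] {T C : ℝ}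
    {g g' : ℝ → X} (hg : ∀ t ∈ Icc 0 T, HasDerivWithinAt g (g' t) (Icc 0 T) t)
    (hC : ∀ t ∈ Icc 0 T, ‖g' t‖ ≤ C) (h0 : g 0 = 0) {t : ℝ} (ht : t ∈ Icc 0 T) :
    ‖g t‖ ≤ T * C := by
  have h1 := (convex_Icc 0 T).norm_image_sub_le_of_norm_hasDerivWithin_le hg hC
    (x := 0) (y := t) ⟨le_rfl, ht.1.trans ht.2⟩ ht
  rw [h0, sub_zero, sub_zero, Real.norm_eq_abs, abs_of_nonneg ht.1] at h1
  have hC0 : 0 ≤ C := (norm_nonneg _).trans (hC t ht)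
  rw [mul_comm]
  exact h1.trans (mul_le_mul_of_nonneg_left ht.2 hC0)

end Limits

/-! ### Stability in `H¹`, closedness under limits, and uniqueness. -/

section Closedness

variable {T c : ℝ} {g₀ g₁ A A' B B' : ℝ → ℝ} {K L : ℝ} {p u v z : ℝ → H1 0 1}

theorem IsClassicalSolution.continuousOn_derivWithin_u (hT : 0 < T)
    (H : IsClassicalSolution T c g₀ g₁ A p u) :
    ContinuousOn (derivWithin (fun t => (u t).1 0) (Icc 0 T)) (Icc 0 T) :=
  H.contDiff_u.continuousOn_derivWithin (uniqueDiffOn_Icc hT) le_rfl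

/-- Solutions depend Lipschitz continuously on the derivative of the law. -/
theorem exists_stability_const (hT : 0 < T) (hK : 0 ≤ K) (L : ℝ) {M : ℝ} (hM0 : 0 ≤ M) :
    ∃ C : ℝ, 0 ≤ C ∧ ∀ {c : ℝ} {g₀ g₁ A A' B B' : ℝ → ℝ} {p u v z : ℝ → H1 0 1} {ε : ℝ},
      IsRegularLaw K L A A' → IsRegularLaw K L B B' → IsClassicalSolution T c g₀ g₁ A p u →
      IsClassicalSolution T c g₀ g₁ B v z → 0 ≤ ε → (∀ s, |A' s - B' s| ≤ ε) →
      (∀ t ∈ Icc 0 T, ‖derivWithin (fun t => (z t).1 0) (Icc 0 T) t‖ ≤ M) →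
      ∀ t ∈ Icc 0 T, ‖p t - v t‖ ≤ C * ε ∧ ‖u t - z t‖ ≤ C * ε ∧
        ‖derivWithin (fun t => (u t).1 0) (Icc 0 T) t
          - derivWithin (fun t => (z t).1 0) (Icc 0 T) t‖ ≤ C * ε := by
  set N := √(3 * M ^ 2 * T * Real.exp ((1 + 3 * K ^ 2 + 12 * (M * L) ^ 2) * T)) with hN
  have hN0 : 0 ≤ N := Real.sqrt_nonneg _
  have hTN : 0 ≤ T * N := mul_nonneg hT.le hN0
  have hKTN : 0 ≤ K * (T * N) := mul_nonneg hK hTN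
  have hTM : 0 ≤ T * M := mul_nonneg hT.le hM0
  -- `N` is the bound on the time derivatives. `T * N` comes from integrating them in time, and the
  -- remaining terms bound `∂ₓ(p - v)` through the momentum equation, where `T * M` bounds the norm
  -- of `z`.
  refine ⟨T * N + N + K * (T * N) + T * M, by positivity, ?_⟩
  intro c g₀ g₁ A A' B B' p u v z ε hA hB H H' hε0 hε hM
  have hW := H.isLinearWave_sub hT hA hB H'
  have hNε : N ^ 2 * ε ^ 2
      = 3 * (M * ε) ^ 2 * T * Real.exp ((1 + 3 * K ^ 2 + 12 * (M * L) ^ 2) * T) := by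
    rw [hN, Real.sq_sqrt (by positivity)]
    ring
  have key := fun t (ht : t ∈ Icc 0 T) => H.deriv_sub_energy_le hT hA hB H' hε0 hε hM ht
  simp only [← hNε, ← mul_pow] at key
  have hNε0 : 0 ≤ N * ε := mul_nonneg hN0 hε0
  have hq' : ∀ t ∈ Icc 0 T, ‖-(u t).1 1 - -(z t).1 1‖ ≤ N * ε := fun t ht =>
    le_of_sq_le_sq ((le_add_of_nonneg_right (sq_nonneg _)).trans (key t ht)) hNε0
  have hw' : ∀ t ∈ Icc 0 T, ‖derivWithin (fun t => (u t).1 0) (Icc 0 T) t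
      - derivWithin (fun t => (z t).1 0) (Icc 0 T) t‖ ≤ N * ε := fun t ht =>
    le_of_sq_le_sq ((le_add_of_nonneg_left (sq_nonneg _)).trans (key t ht)) hNε0
  have hq := fun t (ht : t ∈ Icc 0 T) => norm_le_mul_of_deriv_le hW.deriv_q hq' (by
    show (p 0).1 0 - (v 0).1 0 = 0
    rw [sub_eq_zero]
    refine Lp.ext ?_
    filter_upwards [H.initial_p, H'.initial_p] with x h1 h2
    rw [h1, h2]) ht
  have hw := fun t (ht : t ∈ Icc 0 T) => norm_le_mul_of_deriv_le hW.deriv_w hw' (by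
    show (u 0).1 0 - (z 0).1 0 = 0
    rw [H.u_zero, H'.u_zero, sub_zero]) ht
  have hz := fun t (ht : t ∈ Icc 0 T) => norm_le_mul_of_deriv_le
    (fun t ht => H'.hasDerivWithinAt_u ht) hM H'.u_zero ht
  intro t ht
  have hwx : ‖(u t - z t).1 1‖ ≤ N * ε := by
    have h2 := eq_neg_of_add_eq_zero_left (hW.mass t ht)
    have h3 := hq' t ht
    rwa [h2, norm_neg] at h3
  have hf : ‖hA.comp ((u t).1 0) - hB.comp ((z t).1 0)‖ ≤ K * (T * (N * ε)) + ε * (T * M) := by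
    refine (hA.norm_comp_sub_comp_le hB hε0 hε _ _).trans ?_
    exact add_le_add (mul_le_mul_of_nonneg_left (hw t ht) hK)
      (mul_le_mul_of_nonneg_left (hz t ht) hε0)
  have hqx : ‖(p t - v t).1 1‖ ≤ N * ε + (K * (T * (N * ε)) + ε * (T * M)) := by
    have h2 := hW.momentum t ht
    have h3 : (p t - v t).1 1 = -(derivWithin (fun t => (u t).1 0) (Icc 0 T) t
          - derivWithin (fun t => (z t).1 0) (Icc 0 T) t)
        - (hA.comp ((u t).1 0) - hB.comp ((z t).1 0)) := by
      rw [add_right_comm] at h2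
      rw [eq_neg_of_add_eq_zero_right h2]; abel
    rw [h3]
    refine (norm_sub_le _ _).trans ?_
    rw [norm_neg]
    exact add_le_add (hw' t ht) hf
  have hp1 := (H1.norm_le (p t - v t)).trans (add_le_add (hq t ht) hqx)
  have hu1 := (H1.norm_le (u t - z t)).trans (add_le_add (hw t ht) hwx)
  have i1 : 0 ≤ K * (T * N) * ε := mul_nonneg hKTN hε0
  have i2 : 0 ≤ T * M * ε := mul_nonneg hTM hε0
  have i3 : 0 ≤ T * N * ε := mul_nonneg hTN hε0
  exact ⟨by linarith, by linarith, by linarith [hw' t ht]⟩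

theorem H1.abs_contRep_sub_le (f g : H1 0 1) {x : ℝ} (hx : x ∈ Icc (0 : ℝ) 1) :
    |contRep 0 1 (f.1 0) x - contRep 0 1 (g.1 0) x| ≤ 2 * ‖f - g‖ := by
  rw [← contRep_sub zero_lt_one f.hasWeakDeriv g.hasWeakDeriv hx]
  have h := (f - g).hasWeakDeriv.abs_contRep_le zero_lt_one hx
  rw [sub_zero, Real.sqrt_one, div_one, one_mul, one_mul] at h
  have h0 := sobolev_norm_apply_le (f - g) 0
  have h1 := sobolev_norm_apply_le (f - g) 1
  exact h.trans (by linarith)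

/-- Limits of solutions for converging laws are solutions for the limit law. -/
theorem exists_limit_solution (hT : 0 < T) {An An' : ℕ → ℝ → ℝ} {pn un : ℕ → ℝ → H1 0 1}
    {ε : ℕ → ℝ} (hA : IsRegularLaw K L A A') (hAn : ∀ n, IsRegularLaw K L (An n) (An' n))
    (hε0 : ∀ n, 0 ≤ ε n) (hε : Tendsto ε atTop (𝓝 0)) (hd : ∀ n s, |An' n s - A' s| ≤ ε n)
    (H : ∀ n, IsClassicalSolution T c g₀ g₁ (An n) (pn n) (un n)) :
    ∃ p u : ℝ → H1 0 1, IsClassicalSolution T c g₀ g₁ A p u ∧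
      ∃ C : ℝ, ∀ n, ∀ t ∈ Icc 0 T, ‖pn n t - p t‖ ≤ C * ε n := by
  have hK := hA.nonneg
  have h0 : (0 : ℝ) ∈ Icc 0 T := ⟨le_rfl, hT.le⟩
  obtain ⟨M₀, hM₀⟩ := isCompact_Icc.exists_bound_of_continuousOn
    ((H 0).continuousOn_derivWithin_u hT)
  have hM₀0 : 0 ≤ M₀ := (norm_nonneg _).trans (hM₀ 0 h0)
  obtain ⟨C₁, hC₁0, hC₁⟩ := exists_stability_const hT hK L hM₀0
  -- The stability constant depends on a bound for the time derivative of one of the two solutions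
  -- only. Comparison with the solution of index `0`, whose slope is at distance at most `2 * K`,
  -- gives a bound uniform in `n`.
  have hM : ∀ n, ∀ t ∈ Icc 0 T,
      ‖derivWithin (fun t => (un n t).1 0) (Icc 0 T) t‖ ≤ M₀ + C₁ * (2 * K) := by
    intro n t ht
    have h1 := (hC₁ (hAn n) (hAn 0) (H n) (H 0) (ε := 2 * K) (by positivity) (fun s => by
      refine (abs_sub _ _).trans ?_
      linarith [(hAn n).abs_le s, (hAn 0).abs_le s]) hM₀ t ht).2.2
    have h2 := norm_le_norm_add_norm_sub' (derivWithin (fun t => (un n t).1 0) (Icc 0 T) t)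
      (derivWithin (fun t => (un 0 t).1 0) (Icc 0 T) t)
    linarith [hM₀ t ht]
  obtain ⟨C, hC0, hC⟩ := exists_stability_const hT hK L
    (M := M₀ + C₁ * (2 * K)) (by positivity)
  have hcauchy : ∀ n m, ∀ t ∈ Icc 0 T, ‖pn n t - pn m t‖ ≤ C * (ε n + ε m) ∧
      ‖un n t - un m t‖ ≤ C * (ε n + ε m) := by
    intro n m t ht
    have h1 := hC (hAn n) (hAn m) (H n) (H m) (add_nonneg (hε0 n) (hε0 m)) (fun s => by
      have h2 := hd m s
      rw [abs_sub_comm] at h2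
      refine (abs_sub_le _ (A' s) _).trans (add_le_add (hd n s) h2)) (hM m) t ht
    exact ⟨h1.1, h1.2.1⟩
  obtain ⟨p, hp⟩ := exists_uniform_limit hε fun n m t ht => (hcauchy n m t ht).1
  obtain ⟨u, hu⟩ := exists_uniform_limit hε fun n m t ht => (hcauchy n m t ht).2
  have hCε : Tendsto (fun n => C * ε n) atTop (𝓝 0) := by simpa using hε.const_mul C
  have hpc : ContinuousOn p (Icc 0 T) := (tendstoUniformlyOn_of_norm_le hCε hp).continuousOn
    (Eventually.of_forall fun n => (H n).cont_p).frequently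
  have huc : ContinuousOn u (Icc 0 T) := (tendstoUniformlyOn_of_norm_le hCε hu).continuousOn
    (Eventually.of_forall fun n => (H n).cont_u).frequently
  have hc : ∀ (i : Fin 2) {y : ℝ → H1 0 1}, ContinuousOn y (Icc 0 T) →
      ContinuousOn (fun t => (y t).1 i) (Icc 0 T) := fun i y hy =>
    ((PiLp.continuous_apply 2 _ i).comp continuous_subtype_val).comp_continuousOn hy
  have hcoord : ∀ (i : Fin 2) (x y : H1 0 1), ‖x.1 i - y.1 i‖ ≤ ‖x - y‖ := fun i x y =>
    sobolev_norm_apply_le (x - y) i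
  obtain ⟨R, hR⟩ := isCompact_Icc.exists_bound_of_continuousOn (hc 0 huc)
  obtain ⟨hcp', hdp⟩ := hasDerivWithinAt_of_uniform_limit hT hCε
    (f := fun n t => (pn n t).1 0) (f' := fun n t => -(un n t).1 1) (g := fun t => (p t).1 0)
    (g' := fun t => -(u t).1 1) (fun n t ht => (H n).hasDerivWithinAt_p ht)
    (fun n => (hc 1 (H n).cont_u).neg)
    (fun t ht => tendsto_of_norm_sub_le hCε fun n => (hcoord 0 _ _).trans (hp n t ht))
    (fun n t ht => by
      rw [← neg_sub_neg, neg_neg, neg_neg, norm_sub_rev]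
      exact (hcoord 1 _ _).trans (hu n t ht))
  have hηlim : Tendsto (fun n => C * ε n + (K * (C * ε n) + ε n * R)) atTop (𝓝 0) := by
    have := hCε.add ((hCε.const_mul K).add (hε.mul_const R))
    simpa using this
  have hun' : ∀ n, ∀ t ∈ Icc 0 T, derivWithin (fun t => (un n t).1 0) (Icc 0 T) t
      = -(pn n t).1 1 - (hAn n).comp ((un n t).1 0) := by
    intro n t ht
    have h2 := (H n).derivWithin_u (hAn n) ht
    rw [add_assoc] at h2
    rw [eq_neg_of_add_eq_zero_left h2]; abel
  obtain ⟨hcu', hdu⟩ := hasDerivWithinAt_of_uniform_limit hT hηlim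
    (f := fun n t => (un n t).1 0)
    (f' := fun n => derivWithin (fun t => (un n t).1 0) (Icc 0 T)) (g := fun t => (u t).1 0)
    (g' := fun t => -(p t).1 1 - hA.comp ((u t).1 0))
    (fun n t ht => (H n).hasDerivWithinAt_u ht)
    (fun n => (H n).continuousOn_derivWithin_u hT)
    (fun t ht => tendsto_of_norm_sub_le hCε fun n => (hcoord 0 _ _).trans (hu n t ht))
    (fun n t ht => by
      have e : derivWithin (fun t => (un n t).1 0) (Icc 0 T) t
          - (-(p t).1 1 - hA.comp ((u t).1 0))
          = -((pn n t).1 1 - (p t).1 1)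
            - ((hAn n).comp ((un n t).1 0) - hA.comp ((u t).1 0)) := by
        rw [hun' n t ht]; abel
      rw [e]
      refine (norm_sub_le _ _).trans ?_
      rw [norm_neg]
      refine add_le_add ((hcoord 1 _ _).trans (hp n t ht)) ?_
      refine ((hAn n).norm_comp_sub_comp_le hA (hε0 n) (hd n) _ _).trans ?_
      exact add_le_add
        (mul_le_mul_of_nonneg_left ((hcoord 0 _ _).trans (hu n t ht)) hK)
        (mul_le_mul_of_nonneg_left (hR t ht) (hε0 n)))
  have hU := uniqueDiffOn_Icc hT
  have hC1 : ∀ {y y' : ℝ → L2 0 1}, ContinuousOn y' (Icc 0 T) →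
      (∀ t ∈ Icc 0 T, HasDerivWithinAt y (y' t) (Icc 0 T) t) → ContDiffOn ℝ 1 y (Icc 0 T) := by
    intro y y' hy' hy
    rw [contDiffOn_one_iff_derivWithin hU]
    exact ⟨fun t ht => (hy t ht).differentiableWithinAt,
      hy'.congr fun t ht => (hy t ht).derivWithin (hU t ht)⟩
  have hbdry : ∀ x ∈ Icc (0 : ℝ) 1, ∀ t ∈ Icc 0 T, ∀ b : ℝ,
      (∀ n, contRep 0 1 ((un n t).1 0) x = b) → contRep 0 1 ((u t).1 0) x = b := by
    intro x hx t ht b hb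
    have h1 : Tendsto (fun n => 2 * (C * ε n)) atTop (𝓝 0) := by simpa using hCε.const_mul 2
    have h2 := ge_of_tendsto' h1 (b := |b - contRep 0 1 ((u t).1 0) x|) fun n => by
      rw [← hb n]
      exact (H1.abs_contRep_sub_le _ _ hx).trans
        (mul_le_mul_of_nonneg_left (hu n t ht) zero_le_two)
    exact (sub_eq_zero.1 (abs_nonpos_iff.1 h2)).symm
  have hinit : ∀ {yn : ℕ → ℝ → H1 0 1} {y : ℝ → H1 0 1} (b : ℝ),
      (∀ n, ‖yn n 0 - y 0‖ ≤ C * ε n) →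
      (∀ n, ∀ᵐ x ∂(volume.restrict (Ioo (0 : ℝ) 1)), (yn n 0).1 0 x = b) →
      ∀ᵐ x ∂(volume.restrict (Ioo (0 : ℝ) 1)), (y 0).1 0 x = b := by
    intro yn y b hy hb
    have h1 : ∀ n, (yn n 0).1 0 = (yn 0 0).1 0 := fun n => by
      refine Lp.ext ?_
      filter_upwards [hb n, hb 0] with x e1 e2
      rw [e1, e2]
    have h2 : (y 0).1 0 = (yn 0 0).1 0 := by
      have h3 := ge_of_tendsto' hCε (b := ‖(yn 0 0).1 0 - (y 0).1 0‖) fun n => by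
        rw [← h1 n]
        exact (hcoord 0 _ _).trans (hy n)
      exact (sub_eq_zero.1 (norm_le_zero_iff.1 h3)).symm
    rw [h2]
    exact hb 0
  refine ⟨p, u, ⟨hpc, huc, hC1 hcp' hdp, hC1 hcu' hdu, ?_, ?_, ?_, ?_, ?_, ?_⟩, C, hp⟩
  · intro t ht
    rw [(hdp t ht).derivWithin (hU t ht), neg_add_cancel]
  · intro t ht
    rw [(hdu t ht).derivWithin (hU t ht)]
    filter_upwards [Lp.coeFn_sub (-(p t).1 1) (hA.comp ((u t).1 0)), Lp.coeFn_neg ((p t).1 1),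
      hA.coeFn_comp ((u t).1 0)] with x e1 e2 e3
    rw [e1, Pi.sub_apply, e2, e3, Pi.neg_apply]
    ring
  · exact fun t ht => hbdry 0 (by simp) t ht _ fun n => (H n).boundary_zero t ht
  · exact fun t ht => hbdry 1 (by simp) t ht _ fun n => (H n).boundary_one t ht
  · exact hinit c (fun n => hp n 0 h0) fun n => (H n).initial_p
  · exact hinit 0 (fun n => hu n 0 h0) fun n => (H n).initial_u

/-- Solutions are unique. -/
theorem IsClassicalSolution.unique (hT : 0 < T) (hA : IsRegularLaw K L A A')
    (H : IsClassicalSolution T c g₀ g₁ A p u) (H' : IsClassicalSolution T c g₀ g₁ A v z) {t : ℝ}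
    (ht : t ∈ Icc 0 T) : p t = v t := by
  obtain ⟨M, hM⟩ := isCompact_Icc.exists_bound_of_continuousOn
    (H'.continuousOn_derivWithin_u hT)
  obtain ⟨C, _, hC⟩ := exists_stability_const hT hA.nonneg L ((norm_nonneg _).trans (hM t ht))
  -- Equal laws: the stability estimate with `ε = 0`.
  have h := (hC hA hA H H' le_rfl (fun s => by simp) hM t ht).1
  rw [mul_zero] at h
  exact sub_eq_zero.1 (norm_le_zero_iff.1 h)

end Closedness

/-! ### Continuity of the forward operator. -/

section Forward

variable {T c : ℝ} {g₀ g₁ A A' : ℝ → ℝ} {K L : ℝ} {p u v z : ℝ → H1 0 1}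

/-- The pressure drop of a state. -/
def drop (f : H1 0 1) : ℝ := contRep 0 1 (f.1 0) 0 - contRep 0 1 (f.1 0) 1

theorem abs_drop_sub_le (f g : H1 0 1) : |drop f - drop g| ≤ 4 * ‖f - g‖ := by
  have h0 := H1.abs_contRep_sub_le f g (x := 0) (by simp)
  have h1 := H1.abs_contRep_sub_le f g (x := 1) (by simp)
  have e : drop f - drop g = (contRep 0 1 (f.1 0) 0 - contRep 0 1 (g.1 0) 0)
      - (contRep 0 1 (f.1 0) 1 - contRep 0 1 (g.1 0) 1) := by unfold drop; ring
  rw [e]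
  exact (abs_sub _ _).trans (by linarith)

theorem continuous_drop : Continuous drop :=
  (LipschitzWith.of_dist_le_mul (K := 4) fun f g => by
    rw [Real.dist_eq, dist_eq_norm]; exact abs_drop_sub_le f g).continuous

/-- Point values are continuous on `H¹(0, 1)`, so the drop is a continuous function of time on a
compact interval and hence square integrable. -/
theorem IsClassicalSolution.exists_pressureDrop (H : IsClassicalSolution T c g₀ g₁ A p u) :
    ∃ q : L2 0 T, IsPressureDrop T c g₀ g₁ A q := by
  have hc : ContinuousOn (fun t => drop (p t)) (Icc 0 T) :=
    continuous_drop.comp_continuousOn H.cont_p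
  obtain ⟨C, hC⟩ := isCompact_Icc.exists_bound_of_continuousOn hc
  have hm : MemLp (fun t => drop (p t)) 2 (volume.restrict (Ioo 0 T)) :=
    MemLp.of_bound ((hc.mono Ioo_subset_Icc_self).aestronglyMeasurable measurableSet_Ioo) C
      ((ae_restrict_iff' measurableSet_Ioo).2
        (ae_of_all _ fun t ht => hC t (Ioo_subset_Icc_self ht)))
  exact ⟨hm.toLp, p, u, H, hm.coeFn_toLp⟩

theorem isPressureDrop_forward {l r : ℝ} {a : H2 l r}
    (h : ∃ q : L2 0 T, IsPressureDrop T c g₀ g₁ (dampingLaw a) q) :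
    IsPressureDrop T c g₀ g₁ (dampingLaw a) (forward T c g₀ g₁ a) := by
  have e : forward T c g₀ g₁ a = h.choose := dif_pos h
  rw [e]
  exact h.choose_spec

/-- The forward operator is sequentially continuous along parameters with a solution, and their
limits have a solution as well. -/
theorem tendsto_forward (hT : 0 < T) {a₀ a₁ a₂ a₃ l r : ℝ} (ha₀ : 0 < a₀) (hlr : l < r)
    (hl : l ≤ 0) (hr : 0 ≤ r) {a : H2 l r} {an : ℕ → H2 l r} (ha : a ∈ domain a₀ a₁ a₂ a₃ l r)
    (han : ∀ n, an n ∈ domain a₀ a₁ a₂ a₃ l r) (hlim : Tendsto an atTop (𝓝 a))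
    (hsol : ∀ n, ∃ q : L2 0 T, IsPressureDrop T c g₀ g₁ (dampingLaw (an n)) q) :
    Tendsto (fun n => forward T c g₀ g₁ (an n)) atTop (𝓝 (forward T c g₀ g₁ a)) := by
  choose pn un hpu hq using fun n => isPressureDrop_forward (hsol n)
  obtain ⟨C₀, hC₀0, hC₀⟩ := exists_abs_dampingSlope_sub_le hlr
  have hA := isRegularLaw_dampingLaw hlr hl hr ha₀ ha
  have hε : Tendsto (fun n => C₀ * ‖an n - a‖) atTop (𝓝 0) := by
    simpa using (tendsto_iff_norm_sub_tendsto_zero.1 hlim).const_mul C₀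
  obtain ⟨p, u, H, C, hC⟩ := exists_limit_solution hT hA
    (fun n => isRegularLaw_dampingLaw hlr hl hr ha₀ (han n))
    (fun n => mul_nonneg hC₀0 (norm_nonneg _)) hε (fun n s => hC₀ (an n) a s) hpu
  -- `forward` may have chosen a solution other than the constructed limit; uniqueness identifies
  -- their pressures below.
  obtain ⟨v, z, H', hv⟩ := isPressureDrop_forward H.exists_pressureDrop
  have hbound : Tendsto (fun n => (measureUnivNNReal (volume.restrict (Ioo 0 T)) : ℝ)
      ^ (2 : ℝ≥0∞).toReal⁻¹ * (4 * (C * (C₀ * ‖an n - a‖)))) atTop (𝓝 0) := by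
    have := ((hε.const_mul C).const_mul 4).const_mul
      ((measureUnivNNReal (volume.restrict (Ioo 0 T)) : ℝ) ^ (2 : ℝ≥0∞).toReal⁻¹)
    simpa using this
  refine tendsto_of_norm_sub_le hbound fun n => ?_
  have h0 : (0 : ℝ) ∈ Icc 0 T := ⟨le_rfl, hT.le⟩
  refine Lp.norm_le_of_ae_bound
    (mul_nonneg zero_le_four ((norm_nonneg _).trans (hC n 0 h0))) ?_
  filter_upwards [hq n, hv, Lp.coeFn_sub (forward T c g₀ g₁ (an n)) (forward T c g₀ g₁ a),
    ae_restrict_mem measurableSet_Ioo] with t e1 e2 e3 ht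
  have ht' := Ioo_subset_Icc_self ht
  rw [e3, Pi.sub_apply, e1, e2, ← H.unique hT hA H' ht']
  exact (abs_drop_sub_le (pn n t) (p t)).trans
    (mul_le_mul_of_nonneg_left (hC n t ht') zero_le_four)

end Forward

/-! ### Compactness of the parameter set in `H²`. -/

section Compactness

open BoundedContinuousFunction

variable {l r : ℝ}

/-- The element of `L²(l, r)` given by a continuous function on `[l, r]`. -/
def toL2 (hlr : l ≤ r) (f : Icc l r →ᵇ ℝ) : L2 l r :=
  MemLp.toLp (fun s => f (projIcc l r hlr s)) (MemLp.of_bound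
    (f.continuous.comp continuous_projIcc).aestronglyMeasurable ‖f‖
    (ae_of_all _ fun _ => f.norm_coe_le_norm _))

theorem coeFn_toL2 (hlr : l ≤ r) (f : Icc l r →ᵇ ℝ) :
    toL2 hlr f =ᵐ[volume.restrict (Ioo l r)] fun s => f (projIcc l r hlr s) :=
  MemLp.coeFn_toLp _

theorem continuous_toL2 (hlr : l ≤ r) : Continuous (toL2 hlr) := by
  refine (LipschitzWith.of_dist_le_mul (K := (measureUnivNNReal (volume.restrict (Ioo l r)))
    ^ (2 : ℝ≥0∞).toReal⁻¹) fun f g => ?_).continuous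
  rw [dist_eq_norm, dist_eq_norm, NNReal.coe_rpow]
  refine Lp.norm_le_of_ae_bound (norm_nonneg _) ?_
  filter_upwards [Lp.coeFn_sub (toL2 hlr f) (toL2 hlr g), coeFn_toL2 hlr f, coeFn_toL2 hlr g]
    with s e1 e2 e3
  rw [e1, Pi.sub_apply, e2, e3]
  exact (f - g).norm_coe_le_norm _

/-- Arzelà–Ascoli: the common Lipschitz constant gives equicontinuity, and the conditions are closed
because they involve only point values. -/
theorem isCompact_bounded_lipschitz (l r C k : ℝ) :
    IsCompact {f : Icc l r →ᵇ ℝ | (∀ x, |f x| ≤ C) ∧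
      ∀ x y : Icc l r, |f x - f y| ≤ k * |(x : ℝ) - y|} := by
  have hev : ∀ x : Icc l r, Continuous fun f : Icc l r →ᵇ ℝ => f x := fun x =>
    continuous_eval_const x
  refine arzela_ascoli₂ (Icc (-C) C) isCompact_Icc _ ?_ (fun f x hf => abs_le.1 (hf.1 x)) ?_
  · simp only [ofPred_and, ofPred_forall]
    refine IsClosed.inter (isClosed_iInter fun x => ?_)
      (isClosed_iInter fun x => isClosed_iInter fun y => ?_)
    · exact isClosed_le (hev x).abs continuous_const
    · exact isClosed_le ((hev x).sub (hev y)).abs continuous_const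
  · refine Metric.equicontinuous_of_continuity_modulus (fun d => k * d) ?_ _ ?_
    · have : Continuous fun d : ℝ => k * d := by fun_prop
      simpa using this.tendsto 0
    · intro x y f
      rw [Real.dist_eq, Subtype.dist_eq, Real.dist_eq]
      exact f.2.2 x y

/-- On a bounded interval `L^∞` embeds in `L²`, so the results on continuous representatives apply
to the second derivative as well. -/
theorem exists_weakDeriv_top {a₀ a₁ a₂ a₃ : ℝ} {a : H2 l r} (ha : a ∈ domain a₀ a₁ a₂ a₃ l r) :
    ∃ w : L2 l r, HasWeakDeriv l r (a.1 2) w ∧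
      ∀ᵐ s ∂(volume.restrict (Ioo l r)), |w s| ≤ a₃ := by
  obtain ⟨w, hw, hb⟩ := ha.2.2.2
  have hm : MemLp w 2 (volume.restrict (Ioo l r)) := (Lp.memLp w).mono_exponent le_top
  refine ⟨hm.toLp, hw.congr (ae_eq_refl _) hm.coeFn_toLp.symm, ?_⟩
  filter_upwards [hb, hm.coeFn_toLp] with s h1 h2
  rwa [h2]

/-- Every element of the domain is given by continuous functions with the bounds of the
domain. -/
theorem exists_continuous_reps (hlr : l < r) (hl : l ≤ 0) (hr : 0 ≤ r) {a₀ a₁ a₂ a₃ : ℝ}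
    (ha₀ : 0 < a₀) (ha₁ : 0 < a₁) (ha₂ : 0 < a₂) (ha₃ : 0 < a₃) {a : H2 l r}
    (ha : a ∈ domain a₀ a₁ a₂ a₃ l r) :
    ∃ F : Fin 3 → (Icc l r →ᵇ ℝ), (∀ i, a.1 i = toL2 hlr.le (F i)) ∧
      F 0 ⟨0, hl, hr⟩ = 0 ∧ (∀ x, a₀ ≤ F 1 x ∧ F 1 x ≤ a₁) ∧ (∀ x, |F 2 x| ≤ a₂) ∧
      (∀ x y : Icc l r, |F 2 x - F 2 y| ≤ a₃ * |(x : ℝ) - y|) ∧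
      ∀ i, F i ∈ {f : Icc l r →ᵇ ℝ | (∀ x, |f x| ≤ a₁ + a₂ + a₁ * (r - l)) ∧
        ∀ x y : Icc l r, |f x - f y| ≤ (a₁ + a₂ + a₃) * |(x : ℝ) - y|} := by
  obtain ⟨w, hw, hwb⟩ := exists_weakDeriv_top ha
  have h0 := a.hasWeakDeriv_zero
  have h1 := a.hasWeakDeriv_one
  have hc : ∀ i, ContinuousOn (contRep l r (a.1 i)) (Icc l r) := by
    intro i
    fin_cases i
    · exact h0.continuousOn_contRep hlr
    · exact h1.continuousOn_contRep hlr
    · exact hw.continuousOn_contRep hlr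
  have hae : ∀ i, contRep l r (a.1 i) =ᵐ[volume.restrict (Ioo l r)] a.1 i := by
    intro i
    fin_cases i
    · exact h0.contRep_ae_eq hlr
    · exact h1.contRep_ae_eq hlr
    · exact hw.contRep_ae_eq hlr
  have hb1 : ∀ x ∈ Icc l r, a₀ ≤ contRep l r (a.1 1) x ∧ contRep l r (a.1 1) x ≤ a₁ := by
    intro x hx
    refine mem_Icc_of_ae hlr (hc 1) ?_ hx
    filter_upwards [hae 1, ha.2.1] with s e1 e2
    rwa [e1]
  have hb2 : ∀ x ∈ Icc l r, |contRep l r (a.1 2) x| ≤ a₂ := by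
    intro x hx
    refine abs_le.2 (mem_Icc_of_ae hlr (hc 2) ?_ hx)
    filter_upwards [hae 2, ha.2.2.1] with s e1 e2
    rw [e1]
    exact abs_le.1 e2
  have hl0 : ∀ x ∈ Icc l r, ∀ y ∈ Icc l r,
      |contRep l r (a.1 0) x - contRep l r (a.1 0) y| ≤ a₁ * |x - y| := fun x hx y hy =>
    h0.abs_contRep_sub_le_of_bound hlr (by
      filter_upwards [ha.2.1] with s e
      exact abs_le.2 ⟨by linarith [e.1], e.2⟩) hy hx
  have hl1 : ∀ x ∈ Icc l r, ∀ y ∈ Icc l r,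
      |contRep l r (a.1 1) x - contRep l r (a.1 1) y| ≤ a₂ * |x - y| := fun x hx y hy =>
    h1.abs_contRep_sub_le_of_bound hlr ha.2.2.1 hy hx
  have hl2 : ∀ x ∈ Icc l r, ∀ y ∈ Icc l r,
      |contRep l r (a.1 2) x - contRep l r (a.1 2) y| ≤ a₃ * |x - y| := fun x hx y hy =>
    hw.abs_contRep_sub_le_of_bound hlr hwb hy hx
  have hb0 : ∀ x ∈ Icc l r, |contRep l r (a.1 0) x| ≤ a₁ * (r - l) := by
    intro x hx
    have := hl0 x hx 0 ⟨hl, hr⟩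
    rw [ha.1, sub_zero, sub_zero] at this
    refine this.trans (mul_le_mul_of_nonneg_left ?_ ha₁.le)
    exact abs_le.2 ⟨by linarith [hx.1], by linarith [hx.2]⟩
  let F : Fin 3 → (Icc l r →ᵇ ℝ) := fun i =>
    mkOfCompact ⟨fun x : Icc l r => contRep l r (a.1 i) x, (hc i).domRestrict⟩
  have hrl : 0 ≤ a₁ * (r - l) := mul_nonneg ha₁.le (sub_nonneg.2 hlr.le)
  refine ⟨F, fun i => ?_, ha.1, fun x => hb1 x x.2, fun x => hb2 x x.2,
    fun x y => hl2 x x.2 y y.2, fun i => ?_⟩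
  · refine Lp.ext ?_
    filter_upwards [coeFn_toL2 hlr.le (F i), hae i, ae_restrict_mem measurableSet_Ioo]
      with s e1 e2 hs
    rw [e1, ← e2]
    show _ = contRep l r (a.1 i) (projIcc l r hlr.le s)
    rw [projIcc_of_mem hlr.le (Ioo_subset_Icc_self hs)]
  -- The constants are crude sums dominating the bounds of all three orders, so that a single
  -- compact set serves each of them.
  · have hmul : ∀ {k : ℝ} (x y : Icc l r), k ≤ a₁ + a₂ + a₃ →
        k * |(x : ℝ) - y| ≤ (a₁ + a₂ + a₃) * |(x : ℝ) - y| := fun x y hk =>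
      mul_le_mul_of_nonneg_right hk (abs_nonneg _)
    fin_cases i
    · exact ⟨fun x => (hb0 x x.2).trans (by linarith),
        fun x y => (hl0 x x.2 y y.2).trans (hmul x y (by linarith))⟩
    · exact ⟨fun x => (abs_le.2 ⟨by linarith [(hb1 x x.2).1], (hb1 x x.2).2⟩).trans
        (by linarith), fun x y => (hl1 x x.2 y y.2).trans (hmul x y (by linarith))⟩
    · exact ⟨fun x => (hb2 x x.2).trans (by linarith),
        fun x y => (hl2 x x.2 y y.2).trans (hmul x y (by linarith))⟩

/-- A Lipschitz function is absolutely continuous, so its classical derivative, bounded by `k`, is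
its weak one. This recovers the `W^{3,∞}` bound in the limit: the Lipschitz bound on second
derivatives survives uniform limits, while third derivatives need not converge. -/
theorem exists_weakDeriv_of_lipschitz (hlr : l < r) {k : ℝ} (hk : 0 ≤ k) {f : Icc l r →ᵇ ℝ}
    (hf : ∀ x y : Icc l r, |f x - f y| ≤ k * |(x : ℝ) - y|) :
    ∃ w : Lp ℝ ∞ (volume.restrict (Ioo l r)), HasWeakDeriv l r (toL2 hlr.le f) w ∧
      ∀ᵐ s ∂(volume.restrict (Ioo l r)), |w s| ≤ k := by
  set G : ℝ → ℝ := fun s => f (projIcc l r hlr.le s) with hG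
  have hlip : LipschitzWith k.toNNReal G := LipschitzWith.of_dist_le_mul fun x y => by
    rw [Real.dist_eq, Real.dist_eq, Real.coe_toNNReal _ hk]
    exact (hf _ _).trans (mul_le_mul_of_nonneg_left (abs_projIcc_sub_projIcc hlr.le) hk)
  have hd : ∀ s, ‖deriv G s‖ ≤ k := fun s => by
    have := norm_deriv_le_of_lipschitz hlip (x₀ := s)
    rwa [Real.coe_toNNReal _ hk] at this
  have hm : MemLp (deriv G) ∞ (volume.restrict (Ioo l r)) :=
    MemLp.of_bound (measurable_deriv G).aestronglyMeasurable k (ae_of_all _ hd)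
  refine ⟨hm.toLp, ?_, ?_⟩
  · exact (hasWeakDeriv_of_absolutelyContinuous hlr.le
      hlip.lipschitzOnWith.absolutelyContinuousOnInterval).congr (coeFn_toL2 hlr.le f).symm
      hm.coeFn_toLp.symm
  · filter_upwards [hm.coeFn_toLp] with s hs
    rw [hs]
    exact hd s

/-- The domain is sequentially compact in `H²(l, r)`. -/
theorem isSeqCompact_domain (hlr : l < r) (hl : l ≤ 0) (hr : 0 ≤ r) {a₀ a₁ a₂ a₃ : ℝ}
    (ha₀ : 0 < a₀) (ha₁ : 0 < a₁) (ha₂ : 0 < a₂) (ha₃ : 0 < a₃) :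
    IsSeqCompact (domain a₀ a₁ a₂ a₃ l r) := by
  intro a ha
  choose F hF hF0 hF1 hF2 hF3 hFK using fun n =>
    exists_continuous_reps hlr hl hr ha₀ ha₁ ha₂ ha₃ (ha n)
  obtain ⟨G, hGK, φ, hφ, hlim⟩ := (isCompact_univ_pi fun _ : Fin 3 =>
    isCompact_bounded_lipschitz l r (a₁ + a₂ + a₁ * (r - l)) (a₁ + a₂ + a₃)).tendsto_subseq
    (x := F) fun n i _ => hFK n i
  have hlim_i : ∀ i, Tendsto (fun n => F (φ n) i) atTop (𝓝 (G i)) := fun i =>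
    tendsto_pi_nhds.1 hlim i
  have hlim_x : ∀ i x, Tendsto (fun n => F (φ n) i x) atTop (𝓝 (G i x)) := fun i x =>
    ((continuous_eval_const x).tendsto (G i)).comp (hlim_i i)
  let b : PiLp 2 (fun _ : Fin 3 => L2 l r) := WithLp.toLp 2 fun i => toL2 hlr.le (G i)
  have hb : Tendsto (fun n => (a (φ n)).1) atTop (𝓝 b) := by
    have h1 : Tendsto (fun n => fun i => toL2 hlr.le (F (φ n) i)) atTop
        (𝓝 fun i => toL2 hlr.le (G i)) :=
      tendsto_pi_nhds.2 fun i => ((continuous_toL2 hlr.le).tendsto _).comp (hlim_i i)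
    refine (((PiLp.continuous_toLp 2 fun _ : Fin 3 => L2 l r).tendsto _).comp h1).congr fun n => ?_
    refine PiLp.ext fun i => ?_
    exact (hF (φ n) i).symm
  -- The three limits are taken independently; closedness of the Sobolev space makes them a function
  -- and its derivatives.
  have hbm : b ∈ sobolev 2 l r :=
    (isClosed_sobolev 2 l r).mem_of_tendsto hb (Eventually.of_forall fun n => (a (φ n)).2)
  refine ⟨⟨b, hbm⟩, ⟨?_, ?_, ?_, ?_⟩, φ, hφ, tendsto_subtype_rng.2 hb⟩
  · have hc : Continuous fun s => G 0 (projIcc l r hlr.le s) :=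
      (G 0).continuous.comp continuous_projIcc
    show contRep l r (toL2 hlr.le (G 0)) 0 = 0
    rw [contRep_eqOn hlr hc.continuousOn (coeFn_toL2 hlr.le (G 0)).symm ⟨hl, hr⟩]
    simp only []
    rw [projIcc_of_mem hlr.le ⟨hl, hr⟩]
    refine tendsto_nhds_unique (hlim_x 0 _) ?_
    simp only [hF0]
    exact tendsto_const_nhds
  · filter_upwards [coeFn_toL2 hlr.le (G 1)] with s hs
    show a₀ ≤ toL2 hlr.le (G 1) s ∧ toL2 hlr.le (G 1) s ≤ a₁
    rw [hs]
    exact ⟨ge_of_tendsto' (hlim_x 1 _) fun n => (hF1 (φ n) _).1,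
      le_of_tendsto' (hlim_x 1 _) fun n => (hF1 (φ n) _).2⟩
  · filter_upwards [coeFn_toL2 hlr.le (G 2)] with s hs
    show |toL2 hlr.le (G 2) s| ≤ a₂
    rw [hs]
    exact le_of_tendsto' (hlim_x 2 _).abs fun n => hF2 (φ n) _
  · exact exists_weakDeriv_of_lipschitz hlr ha₃.le fun x y =>
      le_of_tendsto' ((hlim_x 2 x).sub (hlim_x 2 y)).abs fun n => hF3 (φ n) x y

end Compactness

/-! ### Convergence of parameters from convergence of data, and the Tikhonov argument. -/

/-- The inverse of the forward operator is sequentially continuous at a parameter that is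
determined by its data. Along parameters with a solution this is compactness and `tendsto_forward`;
the solvability of the boundary value problem itself is not needed. -/
theorem tendsto_of_tendsto_forward {T c : ℝ} {g₀ g₁ : ℝ → ℝ} (hT : 0 < T) {a₀ a₁ a₂ a₃ l r : ℝ}
    (ha₀ : 0 < a₀) (ha₁ : 0 < a₁) (ha₂ : 0 < a₂) (ha₃ : 0 < a₃) (hlr : l < r) (hl : l ≤ 0)
    (hr : 0 ≤ r) {b : H2 l r}
    (huniq : ∀ a ∈ domain a₀ a₁ a₂ a₃ l r, a ≠ b → forward T c g₀ g₁ a ≠ forward T c g₀ g₁ b)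
    {a : ℕ → H2 l r} (ha : ∀ n, a n ∈ domain a₀ a₁ a₂ a₃ l r)
    (hF : Tendsto (fun n => forward T c g₀ g₁ (a n)) atTop (𝓝 (forward T c g₀ g₁ b))) :
    Tendsto a atTop (𝓝 b) := by
  refine tendsto_of_subseq_tendsto fun ns hns => ?_
  obtain ⟨x, hx, φ, hφ, hlim⟩ := isSeqCompact_domain hlr hl hr ha₀ ha₁ ha₂ ha₃
    fun n => ha (ns n)
  refine ⟨φ, ?_⟩
  have hF' := hF.comp (hns.comp hφ.tendsto_atTop)
  suffices hxb : x = b by rw [← hxb]; exact hlim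
  -- If solutions are missing infinitely often, `forward` is `0` there, so the limit datum is `0`
  -- too. Uniqueness at `b` then makes those parameters equal to `b`, and so is the limit.
  by_cases hfreq : ∃ᶠ n in atTop,
      ¬ ∃ q : L2 0 T, IsPressureDrop T c g₀ g₁ (dampingLaw (a (ns (φ n)))) q
  · have h0 : ∃ᶠ n in atTop, forward T c g₀ g₁ (a (ns (φ n))) = 0 :=
      hfreq.mono fun n hn => dif_neg hn
    have hb0 : forward T c g₀ g₁ b = 0 := by
      by_contra hne
      refine h0 ?_
      filter_upwards [hF'.eventually_ne hne] with n hn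
      exact hn
    have hab : ∃ᶠ n in atTop, a (ns (φ n)) = b := h0.mono fun n hn => by
      by_contra hne
      exact huniq _ (ha _) hne (hn.trans hb0.symm)
    by_contra hne
    refine hab ?_
    filter_upwards [hlim.eventually_ne hne] with n hn
    exact hn
  · rw [not_frequently] at hfreq
    obtain ⟨N, hN⟩ := eventually_atTop.1 hfreq
    -- Dropping the first `N` terms leaves a sequence all of whose members have solutions.
    have hs : Tendsto (fun n : ℕ => n + N) atTop atTop := tendsto_add_atTop_nat N
    have h1 := tendsto_forward (c := c) (g₀ := g₀) (g₁ := g₁) hT ha₀ hlr hl hr hx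
      (fun n => ha (ns (φ (n + N)))) (hlim.comp hs) fun n => not_not.1 (hN _ (Nat.le_add_left N n))
    by_contra hne
    exact huniq x hx hne (tendsto_nhds_unique h1 (hF'.comp hs))

end DampedWave

end

theorem mainTheorem8
    -- time horizon, initial pressure and boundary data
    (T : ℝ) (hT : 0 < T) (c : ℝ) (g₀ g₁ : ℝ → ℝ)
    (hg₀ : ContDiffOn ℝ 4 g₀ (Icc 0 T)) (hg₁ : ContDiffOn ℝ 4 g₁ (Icc 0 T))
    (hg₀0 : g₀ 0 = 0) (hg₁0 : g₁ 0 = 0)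
    (hg₀' : derivWithin g₀ (Icc 0 T) 0 = 0) (hg₁' : derivWithin g₁ (Icc 0 T) 0 = 0)
    -- bounds for the parameters and their interval of definition
    (a₀ a₁ a₂ a₃ : ℝ) (ha₀ : 0 < a₀) (ha₁ : 0 < a₁) (ha₂ : 0 < a₂) (ha₃ : 0 < a₃)
    (l r : ℝ) (hlr : l < r) (hl : l ≤ 0) (hr : 0 ≤ r)
    -- true parameter, uniqueness, a-priori guess
    (aDag : DampedWave.H2 l r) (haDag : aDag ∈ DampedWave.domain a₀ a₁ a₂ a₃ l r)
    (huniq : ∀ a ∈ DampedWave.domain a₀ a₁ a₂ a₃ l r, a ≠ aDag →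
      DampedWave.forward T c g₀ g₁ a ≠ DampedWave.forward T c g₀ g₁ aDag)
    (aStar : DampedWave.H2 l r)
    -- noise levels, noisy data, regularization parameters
    (δ α : ℕ → ℝ) (hδ : ℕ → DampedWave.L2 0 T)
    (hnoise : ∀ n, ‖hδ n - DampedWave.forward T c g₀ g₁ aDag‖ ≤ δ n)
    (hδ_lim : Tendsto δ atTop (𝓝 0))
    (hα_pos : ∀ n, 0 < α n) (hα_lim : Tendsto α atTop (𝓝 0))
    (hδα : Tendsto (fun n => δ n ^ 2 / α n) atTop (𝓝 0))
    -- regularized solutions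
    (aReg : ℕ → DampedWave.H2 l r)
    (hmem : ∀ n, aReg n ∈ DampedWave.domain a₀ a₁ a₂ a₃ l r)
    (hmin : ∀ n, IsMinOn (DampedWave.tikhonov T c g₀ g₁ (hδ n) (α n) aStar)
      (DampedWave.domain a₀ a₁ a₂ a₃ l r) (aReg n)) :
    Tendsto (fun n => ‖aReg n - aDag‖) atTop (𝓝 0) := by
  have h1 : ∀ n, ‖DampedWave.forward T c g₀ g₁ (aReg n) - hδ n‖
      ≤ √(δ n ^ 2 + α n * ‖aDag - aStar‖ ^ 2) := by
    intro n
    refine Real.le_sqrt_of_sq_le ?_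
    -- The true parameter is the competitor; discarding the penalty of the minimizer leaves a bound
    -- on the residual that tends to zero.
    have hm : DampedWave.tikhonov T c g₀ g₁ (hδ n) (α n) aStar (aReg n)
        ≤ DampedWave.tikhonov T c g₀ g₁ (hδ n) (α n) aStar aDag := hmin n haDag
    unfold DampedWave.tikhonov at hm
    have h2 : 0 ≤ α n * ‖aReg n - aStar‖ ^ 2 := mul_nonneg (hα_pos n).le (sq_nonneg _)
    have h3 := pow_le_pow_left₀ (norm_nonneg _) (hnoise n) 2
    rw [norm_sub_rev] at h3
    linarith
  have hlim : Tendsto (fun n => √(δ n ^ 2 + α n * ‖aDag - aStar‖ ^ 2) + δ n) atTop (𝓝 0) := by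
    have h2 := (((hδ_lim.pow 2).add (hα_lim.mul_const (‖aDag - aStar‖ ^ 2))).sqrt).add hδ_lim
    simpa using h2
  refine tendsto_iff_norm_sub_tendsto_zero.1
    (DampedWave.tendsto_of_tendsto_forward hT ha₀ ha₁ ha₂ ha₃ hlr hl hr huniq hmem
      (DampedWave.tendsto_of_norm_sub_le hlim fun n => ?_))
  exact (norm_sub_le_norm_sub_add_norm_sub _ (hδ n) _).trans (add_le_add (h1 n) (hnoise n))
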